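/- Let $\mathcal C$ be a triangulated category. A *torsion pair* in $\mathcal C$ is a pair $(\mathcal X,\mathcal Y)$ of full additive subcategories, each closed under isomorphisms and direct summands, such that $\mathcal C(\mathcal X,\mathcal Y)=0$ and every object $C$ lies in a distinguished triangle $X\to C\to Y\to X[1]$ with $X\in\mathcal X$, $Y\in\mathcal Y$. Put $\mathcal W=\mathcal X[1]\cap\mathcal Y$. Let $\mathcal C^+$ be the full subcategory of the objects $C$ for which there is a distinguished triangle $Y\to W\to C\to Y[1]$ with $Y\in\mathcal Y$, $W\in\mathcal W$, and $\mathcal C^-$ that of the objects $C$ for which there is a distinguished triangle $X\to C\to W\to X[1]$ with $X\in\mathcal X$, $W\in\mathcal W$. Let $\underline{\mathcal C}=\mathcal C/\mathcal W$ be the category with the objects of $\mathcal C$ and the morphisms of $\mathcal C$ modulo those that factor through an object of $\mathcal W$, let $\underline{(\ )}:\mathcal C\to\underline{\mathcal C}$ be the quotient functor, and let $\underline{\mathcal C}^{+}=\mathcal C^{+}/\mathcal W$, $\underline{\mathcal C}^{-}=\mathcal C^{-}/\mathcal W$ and the *heart* $\underline{\mathcal H}=(\mathcal C^+\cap\mathcal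 C^-)/\mathcal W$ be the corresponding full subcategories of $\underline{\mathcal C}$. **Theorem.** (1) Let $(\mathcal X,\mathcal Y)$ be any torsion pair in $\mathcal C$. The inclusion $i_+:\underline{\mathcal C}^+\to\underline{\mathcal C}$ has a left adjoint $\tau^+$ and the inclusion $i_-:\underline{\mathcal C}^-\to\underline{\mathcal C}$ has a right adjoint $\tau^-$. Regarding $\tau^\pm$ as endofunctors of $\underline{\mathcal C}$, there is a natural isomorphism $\eta:\tau^+\tau^-\cong\tau^-\tau^+$ with $\eta_C\circ\rho_{\tau^-(C)}=\tau^-(\rho_C)$ for all $C$, where $\rho:\mathrm{Id}\to i_+\tau^+$ is the unit. The functor $\tau^+\tau^-\circ\underline{(\ )}\cong\tau^-\tau^+\circ\underline{(\ )}$ factors, up to isomorphism, through the inclusion $\underline{\mathcal H}\to\underline{\mathcal C}$, and so defines, up to isomorphism, an additive functor $H:\mathcal C\to\underline{\mathcal H}$. The category $\underline{\mathcal H}$, with the additive structure induced from $\mathcal C$, is abelian, and $H$ is cohomological: for every distinguished triangle $A\xrightarrow{f}B\xrightarrow{g}C\to A[1]$ the sequence $H(A)\xrightarrow{H(f)}H(B)\xrightarrow{H(g)}H(C)$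 is exact in $\underline{\mathcal H}$. (2) For every t-structure $(\mathcal C^{\le 0},\mathcal C^{\ge 0})$ on $\mathcal C$, the pair $(\mathcal C^{\le 0},\mathcal C^{\ge 1})$ is a torsion pair. For this pair the functor $\underline{(\ )}:\mathcal C\to\underline{\mathcal C}$ is an equivalence, $\mathcal C^+=\mathcal C^{\ge 0}$, $\mathcal C^-=\mathcal C^{\le 0}$, $\mathcal C^+\cap\mathcal C^-$ is the heart of the t-structure, and $H$ is, up to this equivalence and up to isomorphism, the functor $\tau^{\ge 0}\tau^{\le 0}$. (3) Let $\mathcal T\subseteq\mathcal C$ be a cluster tilting subcategory, that is, $\mathcal T$ is functorially finite and, for every object $C$, one has $C\in\mathcal T$ if and only if $\mathcal C(\mathcal T,C[1])=0$, and also $C\in\mathcal T$ if and only if $\mathcal C(C,\mathcal T[1])=0$. Then $(\mathcal T[-1],\mathcal T)$ is a torsion pair. For this pair $\mathcal W=\mathcal T$, $\mathcal C^+=\mathcal C^-=\mathcal C$, the inclusion $\underline{\mathcal H}\to\underline{\mathcal C}=\mathcal C/\mathcal T$ is an equivalence, and $H$ is, up to this equivalence and up to isomorphism, the quotient functor $\mathcal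 C\to\mathcal C/\mathcal T$. -/

import Mathlib

open CategoryTheory CategoryTheory.Limits CategoryTheory.Pretriangulated
  CategoryTheory.Triangulated

open scoped ZeroObject

universe v u

section TorsionPairs

variable (C : Type u) [Category.{v} C] [Preadditive C] [HasZeroObject C] [HasShift C ℤ]
  [∀ n : ℤ, (shiftFunctor C n).Additive] [Pretriangulated C]

/-- A torsion pair `(X, Y)` in a triangulated category: two full additive subcategories, closed
under direct summands (hence under isomorphisms), with `C(X, Y) = 0`, and such that every object
`A` sits in a distinguished triangle `A' ⟶ A ⟶ A'' ⟶ A'⟦1⟧` with `A'` in `X` and `A''` in `Y`.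
No stability under the shift is required. -/
structure TorsionPair where
  X : ObjectProperty C
  Y : ObjectProperty C
  additive_X : X.IsClosedUnderFiniteProducts
  additive_Y : Y.IsClosedUnderFiniteProducts
  thick_X : X.IsStableUnderRetracts
  thick_Y : Y.IsStableUnderRetracts
  zero : ∀ ⦃A B : C⦄ (f : A ⟶ B), X A → Y B → f = 0
  exists_triangle : ∀ A : C, ∃ (A' A'' : C) (f : A' ⟶ A) (g : A ⟶ A'') (h : A'' ⟶ A'⟦(1 : ℤ)⟧),
    X A' ∧ Y A'' ∧ Triangle.mk f g h ∈ distTriang C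

variable {C}

/-- A cluster tilting subcategory `T`: every object has a right and a left `T`-approximation
(`T` is functorially finite), and `T` consists exactly of the objects `A` with
`C(T, A⟦1⟧) = 0`, and exactly of the objects `A` with `C(A, T⟦1⟧) = 0`. -/
structure IsClusterTilting (T : ObjectProperty C) : Prop where
  contravariantlyFinite : ∀ A : C, ∃ (T₀ : C) (p : T₀ ⟶ A), T T₀ ∧
    ∀ (T₁ : C) (f : T₁ ⟶ A), T T₁ → ∃ g : T₁ ⟶ T₀, g ≫ p = f
  covariantlyFinite : ∀ A : C, ∃ (T₀ : C) (i : A ⟶ T₀), T T₀ ∧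
    ∀ (T₁ : C) (f : A ⟶ T₁), T T₁ → ∃ g : T₀ ⟶ T₁, i ≫ g = f
  iff_right : ∀ A : C, T A ↔ ∀ (T₀ : C) (f : T₀ ⟶ A⟦(1 : ℤ)⟧), T T₀ → f = 0
  iff_left : ∀ A : C, T A ↔ ∀ (T₀ : C) (f : A ⟶ T₀⟦(1 : ℤ)⟧), T T₀ → f = 0

namespace TorsionPair

variable (P : TorsionPair C)

/-- The subcategory `X[1]`: an object `A` lies in `X[1]` iff `A⟦-1⟧` lies in `X`. -/
def X₁ : ObjectProperty C := P.X.shift (-1 : ℤ)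

/-- `W = X[1] ∩ Y`. -/
def W : ObjectProperty C := P.X₁ ⊓ P.Y

/-- `C⁺`: objects `A` with a distinguished triangle `B ⟶ B' ⟶ A ⟶ B⟦1⟧`, `B ∈ Y`, `B' ∈ W`. -/
def plus : ObjectProperty C := fun A ↦
  ∃ (B B' : C) (f : B ⟶ B') (g : B' ⟶ A) (h : A ⟶ B⟦(1 : ℤ)⟧),
    P.Y B ∧ P.W B' ∧ Triangle.mk f g h ∈ distTriang C

/-- `C⁻`: objects `A` with a distinguished triangle `B ⟶ A ⟶ B' ⟶ B⟦1⟧`, `B ∈ X`, `B' ∈ W`. -/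
def minus : ObjectProperty C := fun A ↦
  ∃ (B B' : C) (f : B ⟶ A) (g : A ⟶ B') (h : B' ⟶ B⟦(1 : ℤ)⟧),
    P.X B ∧ P.W B' ∧ Triangle.mk f g h ∈ distTriang C

/-- Two parallel morphisms are identified when their difference factors through an object
of `W`. -/
def rel : HomRel C := fun A B f g ↦
  ∃ (D : C) (a : A ⟶ D) (b : D ⟶ B), P.W D ∧ f - g = a ≫ b

lemma W_zero : P.W 0 := by
  have := P.additive_X
  have := P.additive_Y
  have := P.thick_X
  have := P.thick_Y
  refine ⟨?_, P.Y.prop_zero⟩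
  exact P.X.prop_of_isZero ((shiftFunctor C (-1 : ℤ)).map_isZero (isZero_zero C))

lemma W_biprod {A B : C} (hA : P.W A) (hB : P.W B) : P.W (A ⊞ B) := by
  have := P.additive_X
  have := P.additive_Y
  have := P.thick_X
  have := P.thick_Y
  have : PreservesBinaryBiproducts (shiftFunctor C (-1 : ℤ)) :=
    preservesBinaryBiproducts_of_preservesBiproducts _
  constructor
  · exact P.X.prop_of_iso ((shiftFunctor C (-1 : ℤ)).mapBiprod A B).symm
      (P.X.prop_of_iso (biprod.isoProd _ _).symm (P.X.prop_prod _ _ hA.1 hB.1))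
  · exact P.Y.prop_of_iso (biprod.isoProd _ _).symm (P.Y.prop_prod _ _ hA.2 hB.2)

lemma rel_add ⦃A B : C⦄ (f₁ f₂ g₁ g₂ : A ⟶ B) (hf : P.rel f₁ f₂) (hg : P.rel g₁ g₂) :
    P.rel (f₁ + g₁) (f₂ + g₂) := by
  obtain ⟨D, a, b, hD, h⟩ := hf
  obtain ⟨E, c, d, hE, h'⟩ := hg
  refine ⟨D ⊞ E, biprod.lift a c, biprod.desc b d, P.W_biprod hD hE, ?_⟩
  rw [biprod.lift_desc, ← h, ← h']
  abel

instance congruence_rel : Congruence P.rel where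
  equivalence :=
    { refl := fun f ↦ ⟨0, 0, 0, P.W_zero, by simp⟩
      symm := by
        rintro f g ⟨D, a, b, hD, h⟩
        exact ⟨D, -a, b, hD, by rw [Preadditive.neg_comp, ← h, neg_sub]⟩
      trans := by
        rintro f g k ⟨D, a, b, hD, h⟩ ⟨E, c, d, hE, h'⟩
        refine ⟨D ⊞ E, biprod.lift a c, biprod.desc b d, P.W_biprod hD hE, ?_⟩
        rw [biprod.lift_desc, ← h, ← h', sub_add_sub_cancel] }
  comp_left := by
    rintro A B E f g g' ⟨D, a, b, hD, h⟩
    exact ⟨D, f ≫ a, b, hD, by rw [Category.assoc, ← h, Preadditive.comp_sub]⟩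
  comp_right := by
    rintro A B E f f' g ⟨D, a, b, hD, h⟩
    exact ⟨D, a, b ≫ g, hD, by rw [← Category.assoc, ← h, Preadditive.sub_comp]⟩

/-- The quotient category `C/W`. -/
abbrev Quot := CategoryTheory.Quotient P.rel

/-- The additive structure of `C/W` induced from `C`. -/
instance preadditiveQuot : Preadditive P.Quot := CategoryTheory.Quotient.preadditive _ P.rel_add

/-- The quotient functor `C ⥤ C/W`. -/
abbrev π : C ⥤ P.Quot := CategoryTheory.Quotient.functor P.rel

/-- For a subcategory `S` of `C`, the property of objects of `C/W` of lying in `S`. -/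
def bar (S : ObjectProperty C) : ObjectProperty P.Quot := fun A ↦ S A.as

/-- The full subcategory `C⁺/W` of `C/W`. -/
abbrev Plus := (P.bar P.plus).FullSubcategory

/-- The full subcategory `C⁻/W` of `C/W`. -/
abbrev Minus := (P.bar P.minus).FullSubcategory

/-- The heart `(C⁺ ∩ C⁻)/W`, a full subcategory of `C/W`. -/
abbrev Heart := (P.bar (P.plus ⊓ P.minus)).FullSubcategory

/-- The inclusion of `C⁺/W` in `C/W`. -/
abbrev ιPlus : P.Plus ⥤ P.Quot := (P.bar P.plus).ι

/-- The inclusion of `C⁻/W` in `C/W`. -/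
abbrev ιMinus : P.Minus ⥤ P.Quot := (P.bar P.minus).ι

/-- The inclusion of the heart in `C/W`. -/
abbrev ιHeart : P.Heart ⥤ P.Quot := (P.bar (P.plus ⊓ P.minus)).ι

/-- `H : C ⥤ Heart` is the functor associated with `P`, which is determined up to isomorphism:
composed with the inclusion of the heart in `C/W` it is isomorphic to `τ⁺τ⁻` after the quotient
functor, where `τ⁺` is left adjoint to the inclusion of `C⁺/W` and `τ⁻` is right adjoint to the
inclusion of `C⁻/W`. -/
def IsHeartFunctor (H : C ⥤ P.Heart) : Prop :=
  ∃ (τp : P.Quot ⥤ P.Plus) (_ : τp ⊣ P.ιPlus) (τm : P.Quot ⥤ P.Minus) (_ : P.ιMinus ⊣ τm),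
    Nonempty (H ⋙ P.ιHeart ≅ P.π ⋙ (τm ⋙ P.ιMinus) ⋙ (τp ⋙ P.ιPlus))

end TorsionPair

end TorsionPairs

/-! Membership in `C⁺` and `C⁻` amounts to a vanishing condition: `A` lies in `C⁺` iff every
composite `D ⟶ B ⟶ A` with `D` in `X` and `B` in `X[1]` is zero, and in `C⁻` iff every composite `A
⟶ B ⟶ D` with `B` in `Y` and `D` in `Y[1]` is zero (`plus_comp_zero`, `plus_of_forall` and their
duals). There are no nonzero maps from `X` to `W` or from `W` to `Y[1]`, so maps out of `X` or into
`Y[1]` that vanish in `C/W` already vanish in `C`; the conditions can be tested in the quotient.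

The reflection of `A` in `C⁺` is the cone of `X ⟶ U ⟶ A`, where `U ⟶ A` approximates `A` by `X[1]`
and `X ⟶ U` approximates `U` by `X`; the octahedral axiom puts this cone in `C⁺`. The coreflection
is dual. Reflecting preserves `C⁻` and coreflecting preserves `C⁺`, so both composites land in the
heart.

In the heart, cokernels are reflections of suitable cones and kernels are coreflections of suitable
fibres. For normality, a morphism is replaced by a congruent one whose cone is controlled by an
octahedron (`exists_representative`). The comparison `τ⁺τ⁻ ⟶ τ⁻τ⁺` is mono and epi in the abelian
heart, hence invertible. Exactness of `H` means that kernel followed by cokernel is zero, which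
reduces to a chase in one triangle (`π_comp_eq_zero`).

For a t-structure `W` is zero; for a cluster tilting subcategory `X[1] = Y = T`, and the vanishing
conditions hold for every object. -/

namespace TorsionPair

/-! ### Lifting and extending maps along distinguished triangles. -/

section Triangles

variable {C : Type u} [Category.{v} C] [Preadditive C] [HasZeroObject C] [HasShift C ℤ]
  [∀ n : ℤ, (shiftFunctor C n).Additive] [Pretriangulated C]
  {A B D E : C} {f : A ⟶ B} {g : B ⟶ D} {h : D ⟶ A⟦(1 : ℤ)⟧}

lemma exists_desc₂ (hT : Triangle.mk f g h ∈ distTriang C) (k : B ⟶ E) (hk : f ≫ k = 0) :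
    ∃ l : D ⟶ E, k = g ≫ l := Triangle.yoneda_exact₂ _ hT k hk

lemma exists_desc₃ (hT : Triangle.mk f g h ∈ distTriang C) (k : D ⟶ E) (hk : g ≫ k = 0) :
    ∃ l : A⟦(1 : ℤ)⟧ ⟶ E, k = h ≫ l := Triangle.yoneda_exact₃ _ hT k hk

lemma exists_lift₂ (hT : Triangle.mk f g h ∈ distTriang C) (k : E ⟶ B) (hk : k ≫ g = 0) :
    ∃ l : E ⟶ A, k = l ≫ f := Triangle.coyoneda_exact₂ _ hT k hk

lemma exists_lift₃ (hT : Triangle.mk f g h ∈ distTriang C) (k : E ⟶ D) (hk : k ≫ h = 0) :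
    ∃ l : E ⟶ B, k = l ≫ g := Triangle.coyoneda_exact₃ _ hT k hk

lemma dist_zero₁₂ (hT : Triangle.mk f g h ∈ distTriang C) : f ≫ g = 0 :=
  comp_distTriang_mor_zero₁₂ _ hT

lemma dist_zero₂₃ (hT : Triangle.mk f g h ∈ distTriang C) : g ≫ h = 0 :=
  comp_distTriang_mor_zero₂₃ _ hT

lemma rotate_dist (hT : Triangle.mk f g h ∈ distTriang C) :
    Triangle.mk g h (-f⟦1⟧') ∈ distTriang C :=
  rot_of_distTriang _ hT

lemma exists_desc₁ (hT : Triangle.mk f g h ∈ distTriang C) (k : A ⟶ E)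
    (hk : h ≫ k⟦(1 : ℤ)⟧' = 0) : ∃ l : B ⟶ E, k = f ≫ l := by
  obtain ⟨l, hl⟩ := exists_desc₃ (rotate_dist hT) (k⟦(1 : ℤ)⟧') hk
  obtain ⟨l, rfl⟩ := (shiftFunctor C (1 : ℤ)).map_surjective l
  refine ⟨-l, (shiftFunctor C (1 : ℤ)).map_injective ?_⟩
  rw [hl, Functor.map_comp, Functor.map_neg, Preadditive.neg_comp, Preadditive.comp_neg]

lemma exists_lift₁ (hT : Triangle.mk f g h ∈ distTriang C) (k : E ⟶ A) (hk : k ≫ f = 0) :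
    ∃ l : E⟦(1 : ℤ)⟧ ⟶ D, k⟦(1 : ℤ)⟧' = l ≫ h :=
  Triangle.coyoneda_exact₁ _ hT _ (by
    change k⟦(1 : ℤ)⟧' ≫ f⟦(1 : ℤ)⟧' = 0
    rw [← Functor.map_comp, hk, Functor.map_zero])

end Triangles

/-! ### Vanishing criteria for `X`, `Y`, `C⁺` and `C⁻`. -/

section Basic

variable {C : Type u} [Category.{v} C] [Preadditive C] [HasZeroObject C] [HasShift C ℤ]
  [∀ n : ℤ, (shiftFunctor C n).Additive] [Pretriangulated C] (P : TorsionPair C)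

/-- The subcategory `Y[1]`: an object `A` lies in `Y[1]` iff `A⟦-1⟧` lies in `Y`. -/
def Y₁ : ObjectProperty C := P.Y.shift (-1 : ℤ)

instance : P.X.IsStableUnderRetracts := P.thick_X
instance : P.Y.IsStableUnderRetracts := P.thick_Y
instance : P.X.IsClosedUnderFiniteProducts := P.additive_X
instance : P.Y.IsClosedUnderFiniteProducts := P.additive_Y

variable {P}

/-- The map from `A` to its `Y`-part vanishes, so `A` is a retract of its `X`-part. -/
lemma X_of_forall {A : C} (h : ∀ (B : C) (f : A ⟶ B), P.Y B → f = 0) : P.X A := by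
  obtain ⟨A', A'', f, g, _, hX, hY, hT⟩ := P.exists_triangle A
  obtain ⟨s, hs⟩ := exists_lift₂ hT (𝟙 A) (by rw [h _ g hY, comp_zero])
  exact P.X.prop_of_retract ⟨s, f, hs.symm⟩ hX

lemma Y_of_forall {A : C} (h : ∀ (B : C) (f : B ⟶ A), P.X B → f = 0) : P.Y A := by
  obtain ⟨A', A'', f, g, _, hX, hY, hT⟩ := P.exists_triangle A
  obtain ⟨s, hs⟩ := exists_desc₂ hT (𝟙 A) (by rw [h _ f hX, zero_comp])
  exact P.Y.prop_of_retract ⟨g, s, hs.symm⟩ hY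

lemma zero₁ {A B : C} (hA : P.X₁ A) (hB : P.Y₁ B) (f : A ⟶ B) : f = 0 :=
  (shiftFunctor C (-1 : ℤ)).map_injective (by
    rw [Functor.map_zero]; exact P.zero _ hA hB)

lemma X₁_shift {A : C} (hA : P.X A) : P.X₁ (A⟦(1 : ℤ)⟧) :=
  P.X.prop_of_iso ((shiftEquiv C (1 : ℤ)).unitIso.app A) hA

lemma Y₁_shift {A : C} (hA : P.Y A) : P.Y₁ (A⟦(1 : ℤ)⟧) :=
  P.Y.prop_of_iso ((shiftEquiv C (1 : ℤ)).unitIso.app A) hA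

lemma X₁_of_forall {A : C} (h : ∀ (B : C) (f : A ⟶ B), P.Y₁ B → f = 0) : P.X₁ A :=
  X_of_forall fun B f hB ↦ (shiftFunctor C (1 : ℤ)).map_injective (by
    rw [Functor.map_zero]
    exact (cancel_epi ((shiftEquiv C (1 : ℤ)).counitIso.inv.app A)).1
      ((h _ _ (Y₁_shift hB)).trans comp_zero.symm))

variable (P) in
-- This is the torsion triangle of `A⟦-1⟧`, shifted and rotated so that `X[1]` approximates `A` from
-- the left.
lemma exists_triangle₁ (A : C) : ∃ (A' A'' : C) (f : A' ⟶ A'') (g : A'' ⟶ A)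
    (h : A ⟶ A'⟦(1 : ℤ)⟧), P.Y A' ∧ P.X₁ A'' ∧ Triangle.mk f g h ∈ distTriang C := by
  obtain ⟨B, D, f, g, h, hX, hY, hT⟩ := P.exists_triangle (A⟦(-1 : ℤ)⟧)
  let e : A⟦(-1 : ℤ)⟧⟦(1 : ℤ)⟧ ≅ A := (shiftEquiv C (1 : ℤ)).counitIso.app A
  refine ⟨D, B⟦(1 : ℤ)⟧, h, (-f⟦1⟧') ≫ e.hom, e.inv ≫ (-g⟦1⟧'), hY, X₁_shift hX,
    isomorphic_distinguished _ (rot_of_distTriang _ (rot_of_distTriang _ hT)) _ ?_⟩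
  refine Triangle.isoMk _ _ (Iso.refl _) (Iso.refl _) e.symm ?_ ?_ ?_
  · exact (Category.comp_id _).trans (Category.id_comp _).symm
  · change ((-f⟦1⟧') ≫ e.hom) ≫ e.inv = 𝟙 _ ≫ (-f⟦1⟧')
    rw [Category.assoc, e.hom_inv_id, Category.comp_id, Category.id_comp]
  · change (e.inv ≫ (-g⟦1⟧')) ≫ (𝟙 D)⟦1⟧' = e.inv ≫ (-g⟦1⟧')
    rw [CategoryTheory.Functor.map_id, Category.comp_id]

lemma zero₂ {A B : C} (hA : P.X₁ A) (hB : P.Y₁ B) (f : A⟦(1 : ℤ)⟧ ⟶ B⟦(1 : ℤ)⟧) : f = 0 := by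
  obtain ⟨f, rfl⟩ := (shiftFunctor C (1 : ℤ)).map_surjective f
  rw [zero₁ hA hB f, Functor.map_zero]

lemma zero_W {A D : C} (hA : P.X A) (hD : P.W D) (f : A ⟶ D) : f = 0 := P.zero f hA hD.2

lemma zero_W₁ {A D : C} (hA : P.Y₁ A) (hD : P.W D) (f : D ⟶ A) : f = 0 := zero₁ hD.1 hA f

/-- The obstruction to lifting `f` to the object of `W` over `A` is a map from `X[1]` to `Y[1]`. -/
lemma plus_factor {A B : C} (hA : P.plus A) (hB : P.X₁ B) (f : B ⟶ A) :
    ∃ (D : C) (a : B ⟶ D) (b : D ⟶ A), P.W D ∧ f = a ≫ b := by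
  obtain ⟨Y, W, g, b, h, hY, hW, hT⟩ := hA
  obtain ⟨a, ha⟩ := exists_lift₃ hT f (zero₁ hB (Y₁_shift hY) _)
  exact ⟨W, a, b, hW, ha⟩

lemma minus_factor {A B : C} (hA : P.minus A) (hB : P.Y B) (f : A ⟶ B) :
    ∃ (D : C) (a : A ⟶ D) (b : D ⟶ B), P.W D ∧ f = a ≫ b := by
  obtain ⟨X, W, g, a, h, hX, hW, hT⟩ := hA
  obtain ⟨b, hb⟩ := exists_desc₂ hT f (P.zero _ hX hB)
  exact ⟨W, a, b, hW, hb⟩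

lemma plus_comp_zero {A B D : C} (hA : P.plus A) (hB : P.X₁ B) (hD : P.X D)
    (g : D ⟶ B) (f : B ⟶ A) : g ≫ f = 0 := by
  obtain ⟨E, a, b, hE, rfl⟩ := plus_factor hA hB f
  rw [← Category.assoc, zero_W hD hE (g ≫ a), zero_comp]

lemma minus_comp_zero {A B D : C} (hA : P.minus A) (hB : P.Y B) (hD : P.Y₁ D)
    (f : A ⟶ B) (g : B ⟶ D) : f ≫ g = 0 := by
  obtain ⟨E, a, b, hE, rfl⟩ := minus_factor hA hB f
  rw [Category.assoc, zero_W₁ hD hE (b ≫ g), comp_zero]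

lemma plus_of_forall {A : C}
    (h : ∀ (B D : C) (g : D ⟶ B) (f : B ⟶ A), P.X₁ B → P.X D → g ≫ f = 0) : P.plus A := by
  obtain ⟨Y, U, i, p, q, hY, hU, hT⟩ := P.exists_triangle₁ A
  -- The `X[1]`-approximation triangle is the required one; only `U ∈ Y` has to be shown.
  refine ⟨Y, U, i, p, q, hY, ⟨hU, Y_of_forall fun B f hB ↦ ?_⟩, hT⟩
  obtain ⟨k, rfl⟩ := exists_lift₂ hT f (h _ _ _ _ hU hB)
  rw [P.zero k hB hY, zero_comp]

lemma minus_of_forall {A : C}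
    (h : ∀ (B D : C) (f : A ⟶ B) (g : B ⟶ D), P.Y B → P.Y₁ D → f ≫ g = 0) : P.minus A := by
  obtain ⟨X, Y, i, p, q, hX, hY, hT⟩ := P.exists_triangle A
  refine ⟨X, Y, i, p, q, hX, ⟨X₁_of_forall fun B f hB ↦ ?_, hY⟩, hT⟩
  obtain ⟨k, rfl⟩ := exists_desc₃ hT f (h _ _ _ _ hY hB)
  rw [zero₁ (X₁_shift hX) hB k, comp_zero]

/-- An extension `B ⟶ A ⟶ D` of an object of `Y[1]` by an object of `Y` lies in `C⁺`. -/
lemma plus_of_triangle {A B D : C} {f : B ⟶ A} {g : A ⟶ D} {h : D ⟶ B⟦(1 : ℤ)⟧}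
    (hT : Triangle.mk f g h ∈ distTriang C) (hB : P.Y B) (hD : P.Y₁ D) : P.plus A :=
  plus_of_forall fun U X a b hU hX ↦ by
    obtain ⟨c, rfl⟩ := exists_lift₂ hT b (zero₁ hU hD _)
    rw [← Category.assoc, P.zero (a ≫ c) hX hB, zero_comp]

lemma minus_of_X {A : C} (hA : P.X A) : P.minus A :=
  minus_of_forall fun _ _ f g hB _ ↦ by rw [P.zero f hA hB, zero_comp]

lemma plus_of_Y₁ {A : C} (hA : P.Y₁ A) : P.plus A :=
  plus_of_forall fun _ _ g f hB _ ↦ by rw [zero₁ hB hA f, comp_zero]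

/-- If the cone of `A ⟶ B` lies in `X[1]` and `A` lies in `C⁻`, so does `B`. -/
lemma minus_of_cone {A B D : C} {f : A ⟶ B} {g : B ⟶ D} {h : D ⟶ A⟦(1 : ℤ)⟧}
    (hT : Triangle.mk f g h ∈ distTriang C) (hA : P.minus A) (hD : P.X₁ D) : P.minus B :=
  minus_of_forall fun Y V a b hY hV ↦ by
    obtain ⟨c, hc⟩ := exists_desc₂ hT (a ≫ b)
      (by rw [← Category.assoc]; exact minus_comp_zero hA hY hV (f ≫ a) b)
    rw [hc, zero₁ hD hV c, comp_zero]

/-- If the fibre of `A ⟶ B` lies in `Y` and `B` lies in `C⁺`, so does `A`. -/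
lemma plus_of_fibre {A B D : C} {f : D ⟶ A} {g : A ⟶ B} {h : B ⟶ D⟦(1 : ℤ)⟧}
    (hT : Triangle.mk f g h ∈ distTriang C) (hB : P.plus B) (hD : P.Y D) : P.plus A :=
  plus_of_forall fun U X a b hU hX ↦ by
    obtain ⟨c, hc⟩ := exists_lift₂ hT (a ≫ b)
      (by rw [Category.assoc]; exact plus_comp_zero hB hU hX a (b ≫ g))
    rw [hc, P.zero c hX hD, zero_comp]

end Basic

/-! ### Adjoints to inclusions, from objectwise universal arrows. -/

section Reflections

variable {D : Type*} [Category* D] {S : ObjectProperty D}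

lemma isRightAdjoint_ι_of_isLocal
    (h : ∀ A : D, ∃ (Z : D) (r : A ⟶ Z), S Z ∧ S.isLocal r) : S.ι.IsRightAdjoint := by
  choose Z r hZ hr using h
  refine ⟨_, ⟨Adjunction.adjunctionOfEquivLeft (F_obj := fun A ↦ ⟨Z A, hZ A⟩)
    (fun A B ↦ S.fullyFaithfulι.homEquiv.trans (Equiv.ofBijective _ (hr A B.1 B.2))) ?_⟩⟩
  intro A B B' g f
  exact (Category.assoc _ _ _).symm

lemma isLeftAdjoint_ι_of_isColocal
    (h : ∀ A : D, ∃ (Z : D) (r : Z ⟶ A), S Z ∧ S.isColocal r) : S.ι.IsLeftAdjoint := by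
  choose Z r hZ hr using h
  let e (A : S.FullSubcategory) (B : D) :
      (A ⟶ (⟨Z B, hZ B⟩ : S.FullSubcategory)) ≃ (A.obj ⟶ B) :=
    S.fullyFaithfulι.homEquiv.trans (Equiv.ofBijective _ (hr B A.1 A.2))
  refine ⟨_, ⟨Adjunction.adjunctionOfEquivRight (G_obj := fun A ↦ ⟨Z A, hZ A⟩)
    (fun A B ↦ (e A B).symm) ?_⟩⟩
  intro A A' B f g
  obtain ⟨k, rfl⟩ := (e A' B).surjective g
  rw [Equiv.symm_apply_eq, Equiv.symm_apply_apply]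
  exact (Category.assoc _ _ _).symm

lemma isLocal_unit {L : D ⥤ S.FullSubcategory} (adj : L ⊣ S.ι) (A : D) :
    S.isLocal (adj.unit.app A) := fun Z hZ ↦ by
  have h := (S.fullyFaithfulι.homEquiv (X := L.obj A) (Y := ⟨Z, hZ⟩)).symm.trans
    (adj.homEquiv A ⟨Z, hZ⟩) |>.bijective
  exact h

lemma isColocal_counit {R : D ⥤ S.FullSubcategory} (adj : S.ι ⊣ R) (A : D) :
    S.isColocal (adj.counit.app A) := fun Z hZ ↦ by
  have h := (S.fullyFaithfulι.homEquiv (X := ⟨Z, hZ⟩) (Y := R.obj A)).symm.trans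
    (adj.homEquiv ⟨Z, hZ⟩ A).symm |>.bijective
  exact h

/-- Two reflections of the same object are isomorphic. -/
lemma exists_iso_of_isLocal {A Z Z' : D} {r : A ⟶ Z} {r' : A ⟶ Z'} (hr : S.isLocal r)
    (hr' : S.isLocal r') (hZ : S Z) (hZ' : S Z') : ∃ e : Z ≅ Z', r ≫ e.hom = r' := by
  obtain ⟨f, hf⟩ := (hr Z' hZ').2 r'
  obtain ⟨g, hg⟩ := (hr' Z hZ).2 r
  dsimp at hf hg
  exact ⟨⟨f, g, (hr Z hZ).1 (by simp [reassoc_of% hf, hg]),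
    (hr' Z' hZ').1 (by simp [reassoc_of% hg, hf])⟩, hf⟩

/-- Two coreflections of the same object are isomorphic. -/
lemma exists_iso_of_isColocal {A Z Z' : D} {r : Z ⟶ A} {r' : Z' ⟶ A} (hr : S.isColocal r)
    (hr' : S.isColocal r') (hZ : S Z) (hZ' : S Z') : ∃ e : Z' ≅ Z, e.hom ≫ r = r' := by
  obtain ⟨f, hf⟩ := (hr Z' hZ').2 r'
  obtain ⟨g, hg⟩ := (hr' Z hZ).2 r
  dsimp at hf hg
  exact ⟨⟨f, g, (hr' Z' hZ').1 (by simp [hg, hf]),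
    (hr Z hZ).1 (by simp [hg, hf])⟩, hf⟩

end Reflections

/-! ### Vanishing of morphisms in `C/W`. -/

section Quotient

variable {C : Type u} [Category.{v} C] [Preadditive C] [HasZeroObject C] [HasShift C ℤ]
  [∀ n : ℤ, (shiftFunctor C n).Additive] [Pretriangulated C] {P : TorsionPair C}

instance additive_π : P.π.Additive := Quotient.functor_additive _ P.rel_add

lemma π_map_eq_zero_iff {A B : C} (f : A ⟶ B) :
    P.π.map f = 0 ↔ ∃ (D : C) (a : A ⟶ D) (b : D ⟶ B), P.W D ∧ f = a ≫ b := by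
  rw [← P.π.map_zero, Quotient.functor_map_eq_iff]
  simp [rel]

lemma exists_π_map {A B : P.Quot} (φ : A ⟶ B) : ∃ f : A.as ⟶ B.as, P.π.map f = φ :=
  P.π.map_surjective (X := A.as) (Y := B.as) φ

lemma π_map_eq_zero {A B D : C} (hD : P.W D) (a : A ⟶ D) (b : D ⟶ B) : P.π.map (a ≫ b) = 0 :=
  (π_map_eq_zero_iff _).2 ⟨D, a, b, hD, rfl⟩

/-- Since `X` has no nonzero maps to `W`, the test composites defining `C⁺` may be computed in
`C/W`; hence `C⁺` is closed under retracts taken there. -/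
lemma eq_zero_of_X {A B : C} (hA : P.X A) (f : A ⟶ B) (hf : P.π.map f = 0) : f = 0 := by
  obtain ⟨D, a, b, hD, rfl⟩ := (π_map_eq_zero_iff f).1 hf
  rw [zero_W hA hD a, zero_comp]

lemma eq_zero_of_Y₁ {A B : C} (hB : P.Y₁ B) (f : A ⟶ B) (hf : P.π.map f = 0) : f = 0 := by
  obtain ⟨D, a, b, hD, rfl⟩ := (π_map_eq_zero_iff f).1 hf
  rw [zero_W₁ hB hD b, comp_zero]

lemma plus_of_split {A B : C} (hA : P.plus A) (f : A ⟶ B) (g : B ⟶ A)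
    (h : P.π.map (g ≫ f) = 𝟙 _) : P.plus B :=
  plus_of_forall fun U X a b hU hX ↦ by
    apply eq_zero_of_X hX
    rw [← Category.comp_id (P.π.map (a ≫ b)), ← h, ← P.π.map_comp, Category.assoc,
      ← Category.assoc b, ← Category.assoc a, plus_comp_zero hA hU hX, zero_comp, P.π.map_zero]

lemma minus_of_split {A B : C} (hA : P.minus A) (f : A ⟶ B) (g : B ⟶ A)
    (h : P.π.map (g ≫ f) = 𝟙 _) : P.minus B :=
  minus_of_forall fun Y V a b hY hV ↦ by
    apply eq_zero_of_Y₁ hV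
    rw [← Category.id_comp (P.π.map (a ≫ b)), ← h, ← P.π.map_comp, Category.assoc,
      ← Category.assoc f, minus_comp_zero hA hY hV, comp_zero, P.π.map_zero]

instance : (P.bar P.plus).IsClosedUnderIsomorphisms where
  of_iso e h := by
    obtain ⟨f, hf⟩ := exists_π_map e.hom
    obtain ⟨g, hg⟩ := exists_π_map e.inv
    exact plus_of_split h f g (by rw [P.π.map_comp, hf, hg]; exact e.inv_hom_id)

instance : (P.bar P.minus).IsClosedUnderIsomorphisms where
  of_iso e h := by
    obtain ⟨f, hf⟩ := exists_π_map e.hom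
    obtain ⟨g, hg⟩ := exists_π_map e.inv
    exact minus_of_split h f g (by rw [P.π.map_comp, hf, hg]; exact e.inv_hom_id)

/-- If the cone of `A ⟶ B` lies in `X[1]`, then `A ⟶ B` is an epimorphism in `C/W` as far as
morphisms to objects of `C⁺` are concerned. -/
lemma π_eq_zero_of_cone {A B D E : C} {f : A ⟶ B} {g : B ⟶ D} {h : D ⟶ A⟦(1 : ℤ)⟧}
    (hT : Triangle.mk f g h ∈ distTriang C) (hD : P.X₁ D)
    (hf : ∀ (W : C) (c : A ⟶ W), P.W W → ∃ c', c = f ≫ c') (hE : P.plus E) (k : B ⟶ E)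
    (hk : P.π.map (f ≫ k) = 0) : P.π.map k = 0 := by
  obtain ⟨W, c, d, hW, hcd⟩ := (π_map_eq_zero_iff _).1 hk
  obtain ⟨c, rfl⟩ := hf W c hW
  -- Once a map through `W` is subtracted, `k` restricts to zero on `A` in `C` itself and so factors
  -- through the cone.
  obtain ⟨l, hl⟩ := exists_desc₂ hT (k - c ≫ d) (by rw [Preadditive.comp_sub, hcd]; simp)
  obtain ⟨V, a, b, hV, rfl⟩ := plus_factor hE hD l
  rw [← sub_add_cancel k (c ≫ d), hl, P.π.map_add, ← Category.assoc, π_map_eq_zero hV,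
    π_map_eq_zero hW, add_zero]

lemma π_eq_zero_of_fibre {A B D E : C} {f : D ⟶ A} {g : A ⟶ B} {h : B ⟶ D⟦(1 : ℤ)⟧}
    (hT : Triangle.mk f g h ∈ distTriang C) (hD : P.Y D)
    (hg : ∀ (W : C) (c : W ⟶ B), P.W W → ∃ c', c = c' ≫ g) (hE : P.minus E) (k : E ⟶ A)
    (hk : P.π.map (k ≫ g) = 0) : P.π.map k = 0 := by
  obtain ⟨W, c, d, hW, hcd⟩ := (π_map_eq_zero_iff _).1 hk
  obtain ⟨d, rfl⟩ := hg W d hW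
  obtain ⟨l, hl⟩ := exists_lift₂ hT (k - c ≫ d) (by rw [Preadditive.sub_comp, hcd]; simp)
  obtain ⟨V, a, b, hV, rfl⟩ := minus_factor hE hD l
  rw [← sub_add_cancel k (c ≫ d), hl, P.π.map_add, Category.assoc, π_map_eq_zero hV,
    π_map_eq_zero hW, add_zero]

end Quotient

/-! ### The reflection in `C⁺` and the coreflection in `C⁻`. -/

section Adjoints

variable {C : Type u} [Category.{v} C] [Preadditive C] [HasZeroObject C] [HasShift C ℤ]
  [∀ n : ℤ, (shiftFunctor C n).Additive] [Pretriangulated C] {P : TorsionPair C}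

/-- A map from `A` to `C⁺` kills `X ⟶ U ⟶ A`, hence extends to `Z`. The extension is unique in `C/W`
because `X[1]` maps to `C⁺` only through `W`. -/
lemma isLocal_of_triangle {X U A Z : C} {a : X ⟶ U} {b : U ⟶ A} {r : A ⟶ Z}
    {h : Z ⟶ X⟦(1 : ℤ)⟧} (hT : Triangle.mk (a ≫ b) r h ∈ distTriang C) (hX : P.X X)
    (hU : P.X₁ U) : (P.bar P.plus).isLocal (P.π.map r) := by
  intro B hB
  constructor
  · intro g₁ g₂ hg
    obtain ⟨g₁, rfl⟩ := exists_π_map g₁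
    obtain ⟨g₂, rfl⟩ := exists_π_map g₂
    have hg : P.π.map r ≫ P.π.map g₁ = P.π.map r ≫ P.π.map g₂ := hg
    rw [← sub_eq_zero, ← P.π.map_sub]
    refine π_eq_zero_of_cone (rotate_dist hT) (X₁_shift hX)
      (fun W c hW ↦ exists_desc₂ hT c (zero_W hX hW _)) hB _ ?_
    rw [Preadditive.comp_sub, P.π.map_sub, P.π.map_comp, P.π.map_comp, hg, sub_self]
  · intro f
    obtain ⟨f, rfl⟩ := exists_π_map f
    obtain ⟨l, rfl⟩ := exists_desc₂ hT f (by
      rw [Category.assoc]; exact plus_comp_zero hB hU hX _ _)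
    exact ⟨P.π.map l, (P.π.map_comp _ _).symm⟩

lemma isColocal_of_triangle {Y V A Z : C} {i : Y ⟶ Z} {r : Z ⟶ A} {a : A ⟶ V}
    {b : V ⟶ Y⟦(1 : ℤ)⟧} (hT : Triangle.mk i r (a ≫ b) ∈ distTriang C) (hY : P.Y Y)
    (hV : P.Y V) : (P.bar P.minus).isColocal (P.π.map r) := by
  intro B hB
  constructor
  · intro g₁ g₂ hg
    obtain ⟨g₁, rfl⟩ := exists_π_map g₁
    obtain ⟨g₂, rfl⟩ := exists_π_map g₂
    have hg : P.π.map g₁ ≫ P.π.map r = P.π.map g₂ ≫ P.π.map r := hg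
    rw [← sub_eq_zero, ← P.π.map_sub]
    refine π_eq_zero_of_fibre hT hY
      (fun W c hW ↦ exists_lift₃ hT c (zero_W₁ (Y₁_shift hY) hW _)) hB _ ?_
    rw [Preadditive.sub_comp, P.π.map_sub, P.π.map_comp, P.π.map_comp, hg, sub_self]
  · intro f
    obtain ⟨f, rfl⟩ := exists_π_map f
    obtain ⟨l, rfl⟩ := exists_lift₃ hT f (by
      rw [← Category.assoc]; exact minus_comp_zero hB hV (Y₁_shift hY) _ _)
    exact ⟨P.π.map l, (P.π.map_comp _ _).symm⟩

variable [IsTriangulated C]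

variable (P) in
-- The octahedron on `X ⟶ U ⟶ A` presents `Z` as an extension of an object of `Y[1]` by an object of
-- `Y`.
lemma exists_reflection (A : C) : ∃ (X U Z : C) (a : X ⟶ U) (b : U ⟶ A) (r : A ⟶ Z)
    (h : Z ⟶ X⟦(1 : ℤ)⟧), P.X X ∧ P.X₁ U ∧ P.plus Z ∧
      Triangle.mk (a ≫ b) r h ∈ distTriang C := by
  obtain ⟨Y, U, i, b, h₂₃, hY, hU, hT⟩ := P.exists_triangle₁ A
  obtain ⟨X, W, a, c, h₁₂, hX, hW, hT'⟩ := P.exists_triangle U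
  obtain ⟨Z, r, h, hT''⟩ := distinguished_cocone_triangle (a ≫ b)
  have o := someOctahedron rfl hT' (rotate_dist hT) hT''
  exact ⟨X, U, Z, a, b, r, h, hX, hU, plus_of_triangle o.mem hW (Y₁_shift hY), hT''⟩

variable (P) in
lemma exists_coreflection (A : C) : ∃ (Y V Z : C) (i : Y ⟶ Z) (r : Z ⟶ A) (a : A ⟶ V)
    (b : V ⟶ Y⟦(1 : ℤ)⟧), P.Y Y ∧ P.Y V ∧ P.minus Z ∧
      Triangle.mk i r (a ≫ b) ∈ distTriang C := by
  obtain ⟨X, V, i, a, h₁₂, hX, hV, hT⟩ := P.exists_triangle A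
  obtain ⟨Y, U, c, d, b, hY, hU, hT'⟩ := P.exists_triangle₁ V
  obtain ⟨Z, j, r, hT''⟩ := distinguished_cocone_triangle₂ (a ≫ b)
  have o := someOctahedron rfl (rotate_dist hT) (rotate_dist (rotate_dist hT'))
    (rotate_dist (rotate_dist hT''))
  refine ⟨Y, V, Z, j, r, a, b, hY, hV, minus_of_forall fun Y' V' f g hY' hV' ↦ ?_, hT''⟩
  -- The octahedron on `A ⟶ V ⟶ Y[1]` gives a triangle `X[1] ⟶ Z[1] ⟶ U[1]`, so the test for `C⁻` is
  -- made after a shift.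
  obtain ⟨k, hk⟩ := exists_desc₂ o.mem (f⟦1⟧') (zero₁ (X₁_shift hX) (Y₁_shift hY') _)
  apply (shiftFunctor C (1 : ℤ)).map_injective
  rw [Functor.map_comp, hk, Category.assoc, zero₂ hU hV' (k ≫ g⟦1⟧'), comp_zero,
    Functor.map_zero]

lemma exists_isLocal (A : P.Quot) : ∃ (Z : P.Quot) (r : A ⟶ Z), P.bar P.plus Z ∧
    (P.bar P.plus).isLocal r := by
  obtain ⟨X, U, Z, a, b, r, h, hX, hU, hZ, hT⟩ := P.exists_reflection A.as
  exact ⟨P.π.obj Z, P.π.map r, hZ, isLocal_of_triangle hT hX hU⟩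

lemma exists_isColocal (A : P.Quot) : ∃ (Z : P.Quot) (r : Z ⟶ A), P.bar P.minus Z ∧
    (P.bar P.minus).isColocal r := by
  obtain ⟨Y, V, Z, i, r, a, b, hY, hV, hZ, hT⟩ := P.exists_coreflection A.as
  exact ⟨P.π.obj Z, P.π.map r, hZ, isColocal_of_triangle hT hY hV⟩

/-- Reflections of objects of `C⁻` lie in `C⁻`. -/
lemma minus_of_isLocal {A Z : P.Quot} {r : A ⟶ Z} (hr : (P.bar P.plus).isLocal r)
    (hZ : P.bar P.plus Z) (hA : P.bar P.minus A) : P.bar P.minus Z := by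
  obtain ⟨X, U, Z', a, b, r', h, hX, hU, hZ', hT⟩ := P.exists_reflection A.as
  obtain ⟨e, -⟩ := exists_iso_of_isLocal (isLocal_of_triangle hT hX hU) hr hZ' hZ
  exact (P.bar P.minus).prop_of_iso e (minus_of_cone (rotate_dist hT) hA (X₁_shift hX))

/-- Coreflections of objects of `C⁺` lie in `C⁺`. -/
lemma plus_of_isColocal {A Z : P.Quot} {r : Z ⟶ A} (hr : (P.bar P.minus).isColocal r)
    (hZ : P.bar P.minus Z) (hA : P.bar P.plus A) : P.bar P.plus Z := by
  obtain ⟨Y, V, Z', i, r', a, b, hY, hV, hZ', hT⟩ := P.exists_coreflection A.as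
  obtain ⟨e, -⟩ := exists_iso_of_isColocal (isColocal_of_triangle hT hY hV) hr hZ' hZ
  exact (P.bar P.plus).prop_of_iso e.symm (plus_of_fibre hT hA hY)

end Adjoints

/-! ### Cones and fibres behind kernels, cokernels and normality. -/

section NormalMorphisms

variable {C : Type u} [Category.{v} C] [Preadditive C] [HasZeroObject C] [HasShift C ℤ]
  [∀ n : ℤ, (shiftFunctor C n).Additive] [Pretriangulated C] {P : TorsionPair C}

/-- The cone is taken of `X ⟶ A ⟶ B` instead of `f`: it remains in `C⁻`, and a map killing `f`
modulo `W` kills `i ≫ f` on the nose, as `X` has no maps to `W`. Reflecting `N` then gives the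
cokernel in the heart. -/
lemma exists_cokernel {A B : C} (f : A ⟶ B) (hA : P.minus A) (hB : P.minus B) :
    ∃ (N : C) (n : B ⟶ N), P.minus N ∧ P.π.map (f ≫ n) = 0 ∧ ∀ (Q : C), P.plus Q →
      (∀ k : B ⟶ Q, P.π.map (f ≫ k) = 0 → ∃ l : N ⟶ Q, k = n ≫ l) ∧
      (∀ l : N ⟶ Q, P.π.map (n ≫ l) = 0 → P.π.map l = 0) := by
  obtain ⟨X, W, i, p, q, hX, hW, hT⟩ := hA
  obtain ⟨N, n, h, hN⟩ := distinguished_cocone_triangle (i ≫ f)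
  refine ⟨N, n, minus_of_cone (rotate_dist hN) hB (X₁_shift hX), ?_, fun Q hQ ↦ ⟨?_, ?_⟩⟩
  · obtain ⟨l, hl⟩ := exists_desc₂ hT (f ≫ n) (by rw [← Category.assoc, dist_zero₁₂ hN])
    rw [hl, π_map_eq_zero hW]
  · intro k hk
    obtain ⟨D, c, d, hD, hcd⟩ := (π_map_eq_zero_iff _).1 hk
    exact exists_desc₂ hN k (by
      rw [Category.assoc, hcd, ← Category.assoc, zero_W hX hD (i ≫ c), zero_comp])
  · exact fun l hl ↦ π_eq_zero_of_cone (rotate_dist hN) (X₁_shift hX)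
      (fun W c hW ↦ exists_desc₂ hN c (zero_W hX hW _)) hQ l hl

/-- Dually, `N` is the fibre of `A ⟶ B ⟶ Y[1]`. -/
lemma exists_kernel {A B : C} (f : A ⟶ B) (hA : P.plus A) (hB : P.plus B) :
    ∃ (N : C) (n : N ⟶ A), P.plus N ∧ P.π.map (n ≫ f) = 0 ∧ ∀ (Q : C), P.minus Q →
      (∀ k : Q ⟶ A, P.π.map (k ≫ f) = 0 → ∃ l : Q ⟶ N, k = l ≫ n) ∧
      (∀ l : Q ⟶ N, P.π.map (l ≫ n) = 0 → P.π.map l = 0) := by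
  obtain ⟨Y, W, i, p, q, hY, hW, hT⟩ := hB
  obtain ⟨N, j, n, hN⟩ := distinguished_cocone_triangle₂ (f ≫ q)
  refine ⟨N, n, plus_of_fibre hN hA hY, ?_, fun Q hQ ↦ ⟨?_, ?_⟩⟩
  · obtain ⟨l, hl⟩ := exists_lift₃ hT (n ≫ f) (by rw [Category.assoc, dist_zero₂₃ hN])
    rw [hl, π_map_eq_zero hW]
  · intro k hk
    obtain ⟨D, c, d, hD, hcd⟩ := (π_map_eq_zero_iff _).1 hk
    exact exists_lift₃ hN k (by
      rw [← Category.assoc, hcd, Category.assoc, zero_W₁ (Y₁_shift hY) hD (d ≫ q), comp_zero])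
  · exact fun l hl ↦ π_eq_zero_of_fibre hN hY
      (fun W c hW ↦ exists_lift₃ hN c (zero_W₁ (Y₁_shift hY) hW _)) hQ l hl

variable [IsTriangulated C]

/-- A representative `f'` of the class of `f` in `C/W`, with a cone that is the cone of a
morphism from the fibre `M` of `A ⟶ B ⟶ Y⟦1⟧` to an object of `W`. -/
lemma exists_representative {A B Y W : C} (f : A ⟶ B) {g : Y ⟶ W} {p : W ⟶ B}
    {β : B ⟶ Y⟦(1 : ℤ)⟧} (hT : Triangle.mk g p β ∈ distTriang C) (hW : P.W W) :
    ∃ (M F : C) (j : Y ⟶ M) (q : M ⟶ A) (m : M ⟶ W) (t : F ⟶ M⟦(1 : ℤ)⟧) (f' : A ⟶ B)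
      (r : B ⟶ F), Triangle.mk j q (f ≫ β) ∈ distTriang C ∧
      Triangle.mk m (p ≫ r) t ∈ distTriang C ∧ Triangle.mk f' r (t ≫ q⟦(1 : ℤ)⟧') ∈ distTriang C ∧
      P.π.map f' = P.π.map f := by
  obtain ⟨M, j, q, hM⟩ := distinguished_cocone_triangle₂ (f ≫ β)
  obtain ⟨m, hm⟩ : ∃ m : M ⟶ W, j ≫ m = g := by
    obtain ⟨m, hm, -⟩ := complete_distinguished_triangle_morphism₂ _ _ hM hT (𝟙 Y) f (by
      change (f ≫ β) ≫ (𝟙 Y)⟦(1 : ℤ)⟧' = f ≫ β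
      rw [CategoryTheory.Functor.map_id, Category.comp_id])
    exact ⟨m, hm.trans (Category.id_comp _)⟩
  obtain ⟨F, s, t, hF⟩ := distinguished_cocone_triangle m
  -- In the octahedron on `Y ⟶ M ⟶ W`, the map `o.m₁` has the same composite with `β` as `f`, so the
  -- two differ by a map through `W`.
  have o := someOctahedron hm hM hF hT
  refine ⟨M, F, j, q, m, t, o.m₁, o.m₃, hM, by rw [o.comm₃]; exact hF, o.mem, ?_⟩
  obtain ⟨l, hl⟩ := exists_lift₃ hT (o.m₁ - f) (by rw [Preadditive.sub_comp, o.comm₂, sub_self])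
  rw [← sub_eq_zero, ← P.π.map_sub, hl, π_map_eq_zero hW]

/-- The hypothesis `hf` is what a monomorphism of the heart supplies. It forces `M ∈ Y`, so maps
from `X[1]` to the cone `F` of `f'` lift to `W`; this puts `N` in `C⁺` and allows maps killed by `n`
to be corrected modulo `W` so as to factor through `f'`. -/
lemma exists_isKernel {A B : C} (f : A ⟶ B) (hA : P.minus A) (hB : P.plus B)
    (hB' : P.minus B) (hf : ∀ (X : C) (a : X ⟶ A), P.X X → P.π.map (a ≫ f) = 0 → a = 0) :
    ∃ (N : C) (n : B ⟶ N), P.plus N ∧ P.minus N ∧ P.π.map (f ≫ n) = 0 ∧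
      ∀ (K : C) (k : K ⟶ B), P.π.map (k ≫ n) = 0 →
        ∃ l : K ⟶ A, P.π.map (l ≫ f) = P.π.map k := by
  obtain ⟨Y, W, g, p, β, hY, hW, hT⟩ := hB
  obtain ⟨M, F, j, q, m, t, f', r, hM, hF, hf', hff'⟩ := exists_representative f hT hW
  obtain ⟨X, V, i, p', h', hX, hV, hA⟩ := hA
  obtain ⟨N, n, h, hN⟩ := distinguished_cocone_triangle (i ≫ f')
  have o := someOctahedron rfl hA hf' hN
  have hMY : P.Y M := Y_of_forall fun X a hX ↦ by
    obtain ⟨c, hc⟩ := exists_lift₃ hT (a ≫ q ≫ f) (by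
      rw [Category.assoc, Category.assoc, dist_zero₂₃ hM, comp_zero])
    obtain ⟨l, rfl⟩ := exists_lift₂ hM a (hf X (a ≫ q) hX (by
      rw [Category.assoc, hc, π_map_eq_zero hW]))
    rw [P.zero l hX hY, zero_comp]
  refine ⟨N, n, plus_of_forall fun U X' a b hU hX' ↦ ?_,
    minus_of_cone (rotate_dist hN) hB' (X₁_shift hX), ?_, fun K k hk ↦ ?_⟩
  · obtain ⟨c, hc⟩ := exists_lift₃ hF (b ≫ o.m₃) (zero₁ hU (Y₁_shift hMY) _)
    obtain ⟨d, hd⟩ := exists_lift₂ o.mem (a ≫ b) (by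
      rw [Category.assoc, hc, ← Category.assoc, zero_W hX' hW (a ≫ c), zero_comp])
    rw [hd, zero_W hX' hV d, zero_comp]
  · obtain ⟨l, hl⟩ := exists_desc₂ hA (f' ≫ n) (by rw [← Category.assoc, dist_zero₁₂ hN])
    rw [P.π.map_comp, ← hff', ← P.π.map_comp, hl, π_map_eq_zero hV]
  · obtain ⟨D, c, d, hD, hcd⟩ := (π_map_eq_zero_iff _).1 hk
    obtain ⟨e, he⟩ := exists_lift₃ hF (d ≫ o.m₃) (zero₁ hD.1 (Y₁_shift hMY) _)
    obtain ⟨l, hl⟩ := exists_lift₂ hf' (k - (c ≫ e) ≫ p) (by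
      rw [Preadditive.sub_comp, ← o.comm₃, ← Category.assoc, hcd, Category.assoc, he]
      simp [o.comm₃])
    refine ⟨l, ?_⟩
    rw [P.π.map_comp, ← hff', ← P.π.map_comp, ← hl, P.π.map_sub, π_map_eq_zero hW, sub_zero]

/-- Dually, `hf` comes from an epimorphism and forces `N ∈ X[1]`; the morphism `f` is then the
cokernel of `M ⟶ A`. -/
lemma exists_isCokernel {A B : C} (f : A ⟶ B) (hA : P.minus A) (hA' : P.plus A)
    (hB : P.plus B) (hf : ∀ (V : C) (b : B ⟶ V), P.Y₁ V → P.π.map (f ≫ b) = 0 → b = 0) :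
    ∃ (N : C) (n : N ⟶ A), P.plus N ∧ P.minus N ∧ P.π.map (n ≫ f) = 0 ∧
      ∀ (Q : C) (k : A ⟶ Q), P.π.map (n ≫ k) = 0 →
        ∃ l : B ⟶ Q, P.π.map (f ≫ l) = P.π.map k := by
  obtain ⟨Y, W, g, p, β, hY, hW, hT⟩ := hB
  obtain ⟨M, F, j, q, m, t, f', r, hM, hF, hf', hff'⟩ := exists_representative f hT hW
  obtain ⟨X, V, i, p', h', hX, hV, hA⟩ := hA
  obtain ⟨N, n, h, hN⟩ := distinguished_cocone_triangle (i ≫ f')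
  have o := someOctahedron rfl hA hf' hN
  have hNX : P.X₁ N := X₁_of_forall fun V' b hV' ↦ by
    obtain ⟨c, hc⟩ := exists_desc₂ hA (f' ≫ n ≫ b) (by
      rw [← Category.assoc, ← Category.assoc, dist_zero₁₂ hN, zero_comp])
    obtain ⟨l, rfl⟩ := exists_desc₃ hN b (hf V' (n ≫ b) hV' (by
      rw [P.π.map_comp, ← hff', ← P.π.map_comp, hc, π_map_eq_zero hV]))
    rw [zero₁ (X₁_shift hX) hV' l, comp_zero]
  refine ⟨M, q, plus_of_fibre hM hA' hY, minus_of_forall fun Y' V' a b hY' hV' ↦ ?_, ?_,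
    fun Q k hk ↦ ?_⟩
  · obtain ⟨c, hc⟩ := exists_desc₃ o.mem (t ≫ a⟦(1 : ℤ)⟧')
      (zero₁ hNX (Y₁_shift hY') _)
    obtain ⟨l, hl⟩ := exists_desc₁ hF (a ≫ b) (by
      rw [Functor.map_comp, ← Category.assoc, hc, Category.assoc,
        zero₂ hV.1 hV' (c ≫ b⟦(1 : ℤ)⟧'), comp_zero])
    rw [hl, zero₁ hW.1 hV' l, comp_zero]
  · obtain ⟨l, hl⟩ := exists_lift₃ hT (q ≫ f) (by rw [Category.assoc, dist_zero₂₃ hM])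
    rw [hl, π_map_eq_zero hW]
  · obtain ⟨D, c, d, hD, hcd⟩ := (π_map_eq_zero_iff _).1 hk
    obtain ⟨e, he⟩ := exists_desc₃ o.mem (t ≫ c⟦(1 : ℤ)⟧') (zero₁ hNX (Y₁_shift hD.2) _)
    obtain ⟨e, rfl⟩ := (shiftFunctor C (1 : ℤ)).map_surjective e
    obtain ⟨l, hl⟩ := exists_desc₁ hf' (k - p' ≫ e ≫ d) (by
      rw [Functor.map_sub, Preadditive.comp_sub, sub_eq_zero, Category.assoc,
        ← Functor.map_comp, hcd, Functor.map_comp, ← Category.assoc, he]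
      simp)
    refine ⟨l, ?_⟩
    rw [P.π.map_comp, ← hff', ← P.π.map_comp, ← hl, P.π.map_sub, π_map_eq_zero hV, sub_zero]

end NormalMorphisms

/-! ### The heart is abelian. -/

section Heart

variable {C : Type u} [Category.{v} C] [Preadditive C] [HasZeroObject C] [HasShift C ℤ]
  [∀ n : ℤ, (shiftFunctor C n).Additive] [Pretriangulated C] {P : TorsionPair C}

/-- The morphism in the heart represented by a morphism of `C`. -/
def heartHom {A B : P.Heart} (f : A.obj.as ⟶ B.obj.as) : A ⟶ B :=
  ObjectProperty.homMk (P.π.map f)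

lemma exists_heartHom {A B : P.Heart} (φ : A ⟶ B) : ∃ f, heartHom f = φ := by
  obtain ⟨f, hf⟩ := exists_π_map φ.hom
  exact ⟨f, ObjectProperty.hom_ext _ hf⟩

lemma heartHom_comp {A B D : P.Heart} (f : A.obj.as ⟶ B.obj.as) (g : B.obj.as ⟶ D.obj.as) :
    heartHom (f ≫ g) = heartHom (A := A) f ≫ heartHom (B := D) g := rfl

lemma heartHom_eq_iff {A B : P.Heart} (f g : A.obj.as ⟶ B.obj.as) :
    heartHom (A := A) (B := B) f = heartHom g ↔ P.π.map f = P.π.map g :=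
  ⟨fun h ↦ P.ιHeart.congr_map h, fun h ↦ ObjectProperty.hom_ext _ h⟩

lemma heartHom_eq_zero_iff {A B : P.Heart} (f : A.obj.as ⟶ B.obj.as) :
    heartHom (A := A) (B := B) f = 0 ↔ P.π.map f = 0 :=
  ⟨fun h ↦ P.ιHeart.congr_map h, fun h ↦ ObjectProperty.hom_ext _ h⟩

lemma plus_biprod {A B : C} (hA : P.plus A) (hB : P.plus B) : P.plus (A ⊞ B) :=
  plus_of_forall fun U X a b hU hX ↦ by
    apply biprod.hom_ext
    · rw [Category.assoc, zero_comp, plus_comp_zero hA hU hX]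
    · rw [Category.assoc, zero_comp, plus_comp_zero hB hU hX]

lemma minus_biprod {A B : C} (hA : P.minus A) (hB : P.minus B) : P.minus (A ⊞ B) :=
  minus_of_forall fun Y V a b hY hV ↦ by
    apply biprod.hom_ext'
    · rw [← Category.assoc, comp_zero, minus_comp_zero hA hY hV]
    · rw [← Category.assoc, comp_zero, minus_comp_zero hB hY hV]

instance hasZeroObject_heart : HasZeroObject P.Heart where
  zero := ⟨⟨P.π.obj 0, plus_of_forall fun _ _ _ _ _ _ ↦ (isZero_zero C).eq_of_tgt _ _,
      minus_of_forall fun _ _ _ _ _ _ ↦ (isZero_zero C).eq_of_src _ _⟩, by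
    rw [IsZero.iff_id_eq_zero]
    apply ObjectProperty.hom_ext
    change P.π.map (𝟙 0) = P.π.map 0
    rw [(isZero_zero C).eq_of_src (𝟙 0) 0]⟩

instance hasBinaryBiproducts_heart : HasBinaryBiproducts P.Heart where
  has_binary_biproduct A B := by
    let S : P.Heart := ⟨P.π.obj (A.obj.as ⊞ B.obj.as),
      plus_biprod A.property.1 B.property.1, minus_biprod A.property.2 B.property.2⟩
    refine hasBinaryBiproduct_of_total
      { pt := S
        fst := heartHom (A := S) biprod.fst
        snd := heartHom (A := S) biprod.snd
        inl := heartHom (B := S) biprod.inl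
        inr := heartHom (B := S) biprod.inr
        inl_fst := by rw [← heartHom_comp, biprod.inl_fst]; rfl
        inl_snd := by rw [← heartHom_comp, biprod.inl_snd]; rfl
        inr_fst := by rw [← heartHom_comp, biprod.inr_fst]; rfl
        inr_snd := by rw [← heartHom_comp, biprod.inr_snd]; rfl } ?_
    apply ObjectProperty.hom_ext
    change P.π.map (biprod.fst ≫ biprod.inl + biprod.snd ≫ biprod.inr) = P.π.map (𝟙 _)
    rw [biprod.total]

instance hasFiniteProducts_heart : HasFiniteProducts P.Heart :=
  hasFiniteProducts_of_has_binary_and_terminal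

variable [IsTriangulated C]

/-- The reflection in `C⁺/W` of an object of `C⁻` lies in the heart. -/
lemma exists_heart_isLocal (A : C) (hA : P.minus A) : ∃ (Z : P.Heart) (r : A ⟶ Z.obj.as),
    (P.bar P.plus).isLocal (P.π.map r) := by
  obtain ⟨X, U, Z, a, b, r, h, hX, hU, hZ, hT⟩ := P.exists_reflection A
  exact ⟨⟨P.π.obj Z, hZ, minus_of_cone (rotate_dist hT) hA (X₁_shift hX)⟩, r,
    isLocal_of_triangle hT hX hU⟩

/-- The coreflection in `C⁻/W` of an object of `C⁺` lies in the heart. -/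
lemma exists_heart_isColocal (A : C) (hA : P.plus A) :
    ∃ (Z : P.Heart) (r : Z.obj.as ⟶ A), (P.bar P.minus).isColocal (P.π.map r) := by
  obtain ⟨Y, V, Z, i, r, a, b, hY, hV, hZ, hT⟩ := P.exists_coreflection A
  exact ⟨⟨P.π.obj Z, plus_of_fibre hT hA hY, hZ⟩, r, isColocal_of_triangle hT hY hV⟩

instance hasCokernels_heart : HasCokernels P.Heart where
  has_colimit {A B} φ := by
    obtain ⟨f, rfl⟩ := exists_heartHom φ
    obtain ⟨N, n, hN, hfn, h⟩ := exists_cokernel f A.property.2 B.property.2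
    obtain ⟨Z, r, hr⟩ := exists_heart_isLocal N hN
    have : Epi (heartHom (A := B) (B := Z) (n ≫ r)) := by
      rw [Preadditive.epi_iff_cancel_zero]
      intro Q g hg
      obtain ⟨g, rfl⟩ := exists_heartHom g
      rw [← heartHom_comp, heartHom_eq_zero_iff, Category.assoc] at hg
      rw [heartHom_eq_zero_iff]
      refine (hr Q.obj Q.property.1).1 (?_ : P.π.map r ≫ P.π.map g = P.π.map r ≫ 0)
      rw [comp_zero, ← P.π.map_comp]
      exact (h _ Q.property.1).2 _ hg
    refine ⟨⟨_, CokernelCofork.IsColimit.ofπ' (heartHom (A := B) (B := Z) (n ≫ r)) ?_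
      fun {Q} k hk ↦ Classical.choice ?_⟩⟩
    · rw [← heartHom_comp, heartHom_eq_zero_iff, ← Category.assoc, P.π.map_comp, hfn, zero_comp]
    · obtain ⟨k, rfl⟩ := exists_heartHom k
      rw [← heartHom_comp, heartHom_eq_zero_iff] at hk
      obtain ⟨l, rfl⟩ := (h _ Q.property.1).1 k hk
      obtain ⟨t, ht⟩ := (hr Q.obj Q.property.1).2 (P.π.map l)
      obtain ⟨t, rfl⟩ := exists_π_map t
      refine ⟨⟨heartHom t, ?_⟩⟩
      rw [← heartHom_comp, heartHom_eq_iff, Category.assoc, P.π.map_comp, P.π.map_comp, P.π.map_comp]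
      exact congrArg (P.π.map n ≫ ·) ht

instance hasKernels_heart : HasKernels P.Heart where
  has_limit {A B} φ := by
    obtain ⟨f, rfl⟩ := exists_heartHom φ
    obtain ⟨N, n, hN, hfn, h⟩ := exists_kernel f A.property.1 B.property.1
    obtain ⟨Z, r, hr⟩ := exists_heart_isColocal N hN
    have : Mono (heartHom (A := Z) (B := A) (r ≫ n)) := by
      rw [Preadditive.mono_iff_cancel_zero]
      intro Q g hg
      obtain ⟨g, rfl⟩ := exists_heartHom g
      rw [← heartHom_comp, heartHom_eq_zero_iff, ← Category.assoc] at hg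
      rw [heartHom_eq_zero_iff]
      refine (hr Q.obj Q.property.2).1 (?_ : P.π.map g ≫ P.π.map r = 0 ≫ P.π.map r)
      rw [zero_comp, ← P.π.map_comp]
      exact (h _ Q.property.2).2 _ hg
    refine ⟨⟨_, KernelFork.IsLimit.ofι' (heartHom (A := Z) (B := A) (r ≫ n)) ?_
      fun {Q} k hk ↦ Classical.choice ?_⟩⟩
    · rw [← heartHom_comp, heartHom_eq_zero_iff, Category.assoc, P.π.map_comp, hfn, comp_zero]
    · obtain ⟨k, rfl⟩ := exists_heartHom k
      rw [← heartHom_comp, heartHom_eq_zero_iff] at hk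
      obtain ⟨l, rfl⟩ := (h _ Q.property.2).1 k hk
      obtain ⟨t, ht⟩ := (hr Q.obj Q.property.2).2 (P.π.map l)
      obtain ⟨t, rfl⟩ := exists_π_map t
      refine ⟨⟨heartHom t, ?_⟩⟩
      rw [← heartHom_comp, heartHom_eq_iff, ← Category.assoc, P.π.map_comp, P.π.map_comp,
        P.π.map_comp]
      exact congrArg (· ≫ P.π.map n) ht

instance isNormalMonoCategory_heart : IsNormalMonoCategory P.Heart where
  normalMonoOfMono {A B} φ _ := by
    obtain ⟨f, rfl⟩ := exists_heartHom φ
    obtain ⟨N, n, hN, hN', hfn, h⟩ := exists_isKernel f A.property.2 B.property.1 B.property.2 (by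
      intro X a hX ha
      -- `X` need not lie in the heart, so cancellation of the monomorphism is applied to the map
      -- that `a` induces on its reflection.
      obtain ⟨Z, r, hr⟩ := exists_heart_isLocal X (minus_of_X hX)
      obtain ⟨t, ht⟩ := (hr A.obj A.property.1).2 (P.π.map a)
      obtain ⟨t, rfl⟩ := exists_π_map t
      replace ht : P.π.map r ≫ P.π.map t = P.π.map a := ht
      have h₀ : heartHom (A := Z) (B := A) t = 0 := by
        rw [← cancel_mono (heartHom (A := A) (B := B) f), zero_comp, ← heartHom_comp,
          heartHom_eq_zero_iff]
        refine (hr B.obj B.property.1).1 (?_ : P.π.map r ≫ P.π.map (t ≫ f) = P.π.map r ≫ 0)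
        rw [P.π.map_comp, ← Category.assoc, ht, ← P.π.map_comp, ha, comp_zero]
      rw [heartHom_eq_zero_iff] at h₀
      exact eq_zero_of_X hX a (by rw [← ht, h₀, comp_zero]))
    let N' : P.Heart := ⟨P.π.obj N, hN, hN'⟩
    have w : heartHom (A := A) (B := B) f ≫ heartHom (B := N') n = 0 := by
      rw [← heartHom_comp, heartHom_eq_zero_iff, hfn]
    refine ⟨⟨N', heartHom n, w, KernelFork.IsLimit.ofι' _ w fun {K} k hk ↦ Classical.choice ?_⟩⟩
    obtain ⟨k, rfl⟩ := exists_heartHom k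
    rw [← heartHom_comp, heartHom_eq_zero_iff] at hk
    obtain ⟨l, hl⟩ := h _ k hk
    exact ⟨⟨heartHom l, (heartHom_eq_iff _ _).2 hl⟩⟩

instance isNormalEpiCategory_heart : IsNormalEpiCategory P.Heart where
  normalEpiOfEpi {A B} φ _ := by
    obtain ⟨f, rfl⟩ := exists_heartHom φ
    obtain ⟨N, n, hN, hN', hfn, h⟩ := exists_isCokernel f A.property.2 A.property.1 B.property.1 (by
      intro V b hV hb
      obtain ⟨Z, r, hr⟩ := exists_heart_isColocal V (plus_of_Y₁ hV)
      obtain ⟨t, ht⟩ := (hr B.obj B.property.2).2 (P.π.map b)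
      obtain ⟨t, rfl⟩ := exists_π_map t
      replace ht : P.π.map t ≫ P.π.map r = P.π.map b := ht
      have h₀ : heartHom (A := B) (B := Z) t = 0 := by
        rw [← cancel_epi (heartHom (A := A) (B := B) f), comp_zero, ← heartHom_comp,
          heartHom_eq_zero_iff]
        refine (hr A.obj A.property.2).1 (?_ : P.π.map (f ≫ t) ≫ P.π.map r = 0 ≫ P.π.map r)
        rw [P.π.map_comp, Category.assoc, ht, ← P.π.map_comp, hb, zero_comp]
      rw [heartHom_eq_zero_iff] at h₀
      exact eq_zero_of_Y₁ hV b (by rw [← ht, h₀, zero_comp]))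
    let N' : P.Heart := ⟨P.π.obj N, hN, hN'⟩
    have w : heartHom (A := N') (B := A) n ≫ heartHom (A := A) (B := B) f = 0 := by
      rw [← heartHom_comp, heartHom_eq_zero_iff, hfn]
    refine ⟨⟨N', heartHom n, w, CokernelCofork.IsColimit.ofπ' _ w fun {K} k hk ↦
      Classical.choice ?_⟩⟩
    obtain ⟨k, rfl⟩ := exists_heartHom k
    rw [← heartHom_comp, heartHom_eq_zero_iff] at hk
    obtain ⟨l, hl⟩ := h _ k hk
    exact ⟨⟨heartHom l, (heartHom_eq_iff _ _).2 hl⟩⟩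

variable (P) in
/-- The heart of a torsion pair is abelian. -/
@[reducible]
def abelianHeart : Abelian P.Heart where

lemma abelianHeart_toPreadditive : (abelianHeart P).toPreadditive =
    Preadditive.fullSubcategory (P.bar (P.plus ⊓ P.minus)) := rfl

end Heart

/-! ### The isomorphism `τ⁺τ⁻ ≅ τ⁻τ⁺`. -/

section Commutation

variable {C : Type u} [Category.{v} C] [Preadditive C] [HasZeroObject C] [HasShift C ℤ]
  [∀ n : ℤ, (shiftFunctor C n).Additive] [Pretriangulated C] {P : TorsionPair C}

/-- If the fibre of `A ⟶ B` lies in `X`, then `A ⟶ B` is an epimorphism in `C/W` as far as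
morphisms to objects of `C⁺` are concerned. -/
lemma π_eq_zero_of_shift_triangle {X A B E : C} {i : X⟦(1 : ℤ)⟧ ⟶ A⟦(1 : ℤ)⟧} {f : A ⟶ B}
    {h : B⟦(1 : ℤ)⟧ ⟶ X⟦(1 : ℤ)⟧⟦(1 : ℤ)⟧}
    (hT : Triangle.mk i (f⟦(1 : ℤ)⟧') h ∈ distTriang C) (hX : P.X X) (hE : P.plus E) (k : B ⟶ E)
    (hk : P.π.map (f ≫ k) = 0) : P.π.map k = 0 := by
  obtain ⟨W, c, d, hW, hcd⟩ := (π_map_eq_zero_iff _).1 hk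
  obtain ⟨i, rfl⟩ := (shiftFunctor C (1 : ℤ)).map_surjective i
  obtain ⟨c', hc⟩ := exists_desc₂ hT (c⟦(1 : ℤ)⟧') (by
    rw [← Functor.map_comp, zero_W hX hW (i ≫ c), Functor.map_zero])
  obtain ⟨c', rfl⟩ := (shiftFunctor C (1 : ℤ)).map_surjective c'
  rw [← Functor.map_comp] at hc
  replace hc := (shiftFunctor C (1 : ℤ)).map_injective hc
  obtain ⟨l, hl⟩ := exists_desc₃ hT ((k - c' ≫ d)⟦(1 : ℤ)⟧') (by
    rw [← Functor.map_comp, Preadditive.comp_sub, ← Category.assoc, ← hc, hcd, sub_self,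
      Functor.map_zero])
  obtain ⟨l, rfl⟩ := (shiftFunctor C (1 : ℤ)).map_surjective l
  obtain ⟨V, a, b, hV, rfl⟩ := plus_factor hE (X₁_shift hX) l
  obtain ⟨e, he⟩ := (shiftFunctor C (1 : ℤ)).map_surjective (h ≫ a⟦(1 : ℤ)⟧')
  rw [Functor.map_comp, ← Category.assoc, ← he, ← Functor.map_comp] at hl
  replace hl := (shiftFunctor C (1 : ℤ)).map_injective hl
  rw [← sub_add_cancel k (c' ≫ d), hl, P.π.map_add, π_map_eq_zero hV, π_map_eq_zero hW, add_zero]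

/-- If the cone of `A ⟶ B` lies in `Y[1]`, then `A ⟶ B` is a monomorphism in `C/W` as far as
morphisms from objects of `C⁻` are concerned. -/
lemma π_eq_zero_of_cone_Y {A B Y E : C} {f : A ⟶ B} {g : B ⟶ Y⟦(1 : ℤ)⟧}
    {h : Y⟦(1 : ℤ)⟧ ⟶ A⟦(1 : ℤ)⟧} (hT : Triangle.mk f g h ∈ distTriang C) (hY : P.Y Y)
    (hE : P.minus E) (k : E ⟶ A) (hk : P.π.map (k ≫ f) = 0) : P.π.map k = 0 := by
  obtain ⟨W, c, d, hW, hcd⟩ := (π_map_eq_zero_iff _).1 hk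
  obtain ⟨d', hd⟩ := exists_lift₂ hT d (zero_W₁ (Y₁_shift hY) hW _)
  obtain ⟨l, hl⟩ := exists_lift₁ hT (k - c ≫ d') (by
    rw [Preadditive.sub_comp, Category.assoc, ← hd, hcd, sub_self])
  obtain ⟨l, rfl⟩ := (shiftFunctor C (1 : ℤ)).map_surjective l
  obtain ⟨V, a, b, hV, rfl⟩ := minus_factor hE hY l
  obtain ⟨e, he⟩ := (shiftFunctor C (1 : ℤ)).map_surjective (b⟦(1 : ℤ)⟧' ≫ h)
  rw [Functor.map_comp, Category.assoc, ← he, ← Functor.map_comp] at hl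
  replace hl := (shiftFunctor C (1 : ℤ)).map_injective hl
  rw [← sub_add_cancel k (c ≫ d'), hl, P.π.map_add, π_map_eq_zero hV, π_map_eq_zero hW, add_zero]

variable [IsTriangulated C]

/-- The coreflection `A' ⟶ Z'` of a reflection `A ⟶ Z` is an epimorphism in `C/W` as far as
morphisms to objects of `C⁺` are concerned. -/
lemma eq_zero_of_coreflection {A Z A' Z' : P.Quot} {r : A ⟶ Z} (hr : (P.bar P.plus).isLocal r)
    (hZ : P.bar P.plus Z) {a : A' ⟶ A} (ha : (P.bar P.minus).isColocal a)
    (hA' : P.bar P.minus A') {z : Z' ⟶ Z} (hz : (P.bar P.minus).isColocal z)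
    (hZ' : P.bar P.minus Z') {g : A' ⟶ Z'} (hg : g ≫ z = a ≫ r) {B : P.Quot}
    (hB : P.bar P.plus B) (k : Z' ⟶ B) (hk : g ≫ k = 0) : k = 0 := by
  obtain ⟨X, U, Z₀, c, d, r₀, h, hX, hU, hZ₀, hT⟩ := P.exists_reflection A.as
  obtain ⟨Y, V, A₀, i, a₀, s, b, hY, hV, hA₀, hT'⟩ := P.exists_coreflection A.as
  -- As `X` has no maps to `V ∈ Y`, the map `A ⟶ V` factors through `Z₀`. The fibre `Q` of `Z₀ ⟶ V ⟶
  -- Y[1]` will be the coreflection of `Z₀`, and the octahedron gives `A₀ ⟶ Q` with fibre `X`.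
  obtain ⟨s, rfl⟩ := exists_desc₂ hT s (P.zero _ hX hV)
  obtain ⟨Q, j, q, hQ⟩ := distinguished_cocone_triangle₂ (s ≫ b)
  have o := someOctahedron (Category.assoc _ _ _).symm (rotate_dist hT)
    (rotate_dist (rotate_dist hQ)) (rotate_dist (rotate_dist hT'))
  obtain ⟨g₀, hg₀⟩ := (shiftFunctor C (1 : ℤ)).map_surjective o.m₃
  have hgq : g₀ ≫ q = a₀ ≫ r₀ := (shiftFunctor C (1 : ℤ)).map_injective (by
    rw [Functor.map_comp, Functor.map_comp, hg₀]
    simpa using o.comm₄.symm)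
  have hmem := o.mem
  rw [← hg₀] at hmem
  have hQm : P.minus Q := minus_of_forall fun Y' V' a b hY' hV' ↦ by
    obtain ⟨l, hl⟩ := exists_desc₃ hmem ((a ≫ b)⟦(1 : ℤ)⟧') (by
      rw [← Functor.map_comp, ← Category.assoc, minus_comp_zero hA₀ hY' hV' (g₀ ≫ a) b,
        Functor.map_zero])
    rw [zero₂ (X₁_shift hX) hV' l, comp_zero] at hl
    exact (shiftFunctor C (1 : ℤ)).map_injective (by rw [hl, Functor.map_zero])
  obtain ⟨e₁, he₁⟩ := exists_iso_of_isLocal hr (isLocal_of_triangle hT hX hU) hZ hZ₀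
  obtain ⟨e₂, he₂⟩ := exists_iso_of_isColocal ha (isColocal_of_triangle hT' hY hV) hA' hA₀
  obtain ⟨e₃, he₃⟩ := exists_iso_of_isColocal hz
    ((P.bar P.minus).isColocal.comp_mem _ _ (isColocal_of_triangle hQ hY hV)
      ((P.bar P.minus).isColocal_of_isIso e₁.inv)) hZ' hQm
  have h₁ : P.π.map g₀ ≫ e₃.hom = e₂.hom ≫ g := (hz _ hA₀).1 (by
    change (P.π.map g₀ ≫ e₃.hom) ≫ z = (e₂.hom ≫ g) ≫ z
    rw [Category.assoc, he₃, ← Category.assoc, ← P.π.map_comp, hgq, P.π.map_comp, ← he₁,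
      Category.assoc, Category.assoc, e₁.hom_inv_id, Category.comp_id, Category.assoc, hg,
      ← Category.assoc, he₂])
  obtain ⟨k₀, hk₀⟩ := exists_π_map (e₃.hom ≫ k)
  rw [← cancel_epi e₃.hom, comp_zero, ← hk₀]
  refine π_eq_zero_of_shift_triangle hmem hX hB k₀ ?_
  rw [P.π.map_comp, hk₀, ← Category.assoc, h₁, Category.assoc, hk, comp_zero]

/-- The morphism `A'' ⟶ Z` induced by a coreflection `A' ⟶ A` on reflections is a monomorphism
in `C/W` as far as morphisms from objects of `C⁻` are concerned. -/
lemma eq_zero_of_reflection {A Z A' A'' : P.Quot} {r : A ⟶ Z} (hr : (P.bar P.plus).isLocal r)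
    (hZ : P.bar P.plus Z) {a : A' ⟶ A} (ha : (P.bar P.minus).isColocal a)
    (hA' : P.bar P.minus A') {r' : A' ⟶ A''} (hr' : (P.bar P.plus).isLocal r')
    (hA'' : P.bar P.plus A'') {g : A'' ⟶ Z} (hg : r' ≫ g = a ≫ r) {B : P.Quot}
    (hB : P.bar P.minus B) (k : B ⟶ A'') (hk : k ≫ g = 0) : k = 0 := by
  obtain ⟨X, U, Z₀, c, d, r₀, h, hX, hU, hZ₀, hT⟩ := P.exists_reflection A.as
  obtain ⟨Y, V, A₀, i, a₀, s, b, hY, hV, hA₀, hT'⟩ := P.exists_coreflection A.as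
  -- As `X[1]` has no maps to `Y[1]`, the map `U ⟶ A` lifts to `A₀`. The cone `Q` of `X ⟶ U ⟶ A₀`
  -- will be the reflection of `A₀`, and the octahedron gives `Q ⟶ Z₀` with cone `Y[1]`.
  obtain ⟨d, rfl⟩ := exists_lift₃ hT' d (zero₁ hU (Y₁_shift hY) _)
  obtain ⟨Q, q, h', hQ⟩ := distinguished_cocone_triangle (c ≫ d)
  have o := someOctahedron (Category.assoc _ _ _) hQ (rotate_dist hT') hT
  have hQp : P.plus Q := plus_of_forall fun U' X' a b hU' hX' ↦ by
    obtain ⟨l, hl⟩ := exists_lift₁ o.mem (a ≫ b) (by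
      rw [Category.assoc, plus_comp_zero hZ₀ hU' hX' a (b ≫ o.m₁)])
    rw [zero₁ (X₁_shift hX') (Y₁_shift hY) l, zero_comp] at hl
    exact (shiftFunctor C (1 : ℤ)).map_injective (by rw [hl, Functor.map_zero])
  obtain ⟨e₁, he₁⟩ := exists_iso_of_isLocal hr (isLocal_of_triangle hT hX hU) hZ hZ₀
  obtain ⟨e₂, he₂⟩ := exists_iso_of_isColocal ha (isColocal_of_triangle hT' hY hV) hA' hA₀
  have hq := isLocal_of_triangle hQ hX hU
  obtain ⟨e₃, he₃⟩ := exists_iso_of_isLocal hr'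
    ((P.bar P.plus).isLocal.comp_mem _ _ ((P.bar P.plus).isLocal_of_isIso e₂.inv) hq) hA'' hQp
  have h₁ : e₃.hom ≫ P.π.map o.m₁ = g ≫ e₁.hom := (hr' _ hZ₀).1 (by
    change r' ≫ e₃.hom ≫ P.π.map o.m₁ = r' ≫ g ≫ e₁.hom
    rw [← Category.assoc, he₃, Category.assoc, ← P.π.map_comp, o.comm₁, P.π.map_comp,
      ← Category.assoc, ← he₂, e₂.inv_hom_id_assoc, ← he₁, ← Category.assoc, ← hg,
      Category.assoc])
  obtain ⟨k₀, hk₀⟩ := exists_π_map (k ≫ e₃.hom)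
  rw [← cancel_mono e₃.hom, zero_comp, ← hk₀]
  refine π_eq_zero_of_cone_Y o.mem hY hB k₀ ?_
  rw [P.π.map_comp, hk₀, Category.assoc, h₁, ← Category.assoc, hk, zero_comp]

variable {τp : P.Quot ⥤ P.Plus} {τm : P.Quot ⥤ P.Minus}

lemma bar_minus_of_minus (adjp : τp ⊣ P.ιPlus) {A : P.Quot} (hA : P.bar P.minus A) :
    P.bar P.minus ((τp ⋙ P.ιPlus).obj A) :=
  minus_of_isLocal (isLocal_unit adjp _) (τp.obj A).property hA

lemma bar_plus_of_plus (adjm : P.ιMinus ⊣ τm) {A : P.Quot} (hA : P.bar P.plus A) :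
    P.bar P.plus ((τm ⋙ P.ιMinus).obj A) :=
  plus_of_isColocal (isColocal_counit adjm _) (τm.obj A).property hA

theorem exists_commutation_iso (adjp : τp ⊣ P.ιPlus) (adjm : P.ιMinus ⊣ τm) :
    ∃ η : (τm ⋙ P.ιMinus) ⋙ (τp ⋙ P.ιPlus) ≅ (τp ⋙ P.ιPlus) ⋙ (τm ⋙ P.ιMinus),
      ∀ A : P.Quot, adjp.unit.app ((τm ⋙ P.ιMinus).obj A) ≫ η.hom.app A =
        (τm ⋙ P.ιMinus).map (adjp.unit.app A) := by
  have hp (A : P.Quot) : P.bar P.plus ((τm ⋙ P.ιMinus).obj ((τp ⋙ P.ιPlus).obj A)) :=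
    bar_plus_of_plus adjm (τp.obj A).property
  have hm (A : P.Quot) : P.bar P.minus ((τp ⋙ P.ιPlus).obj ((τm ⋙ P.ιMinus).obj A)) :=
    bar_minus_of_minus adjp (τm.obj A).property
  have hu (A : P.Quot) := isLocal_unit adjp ((τm ⋙ P.ιMinus).obj A)
  choose η hη using fun A ↦ (hu A _ (hp A)).2 ((τm ⋙ P.ιMinus).map (adjp.unit.app A))
  replace hη (A : P.Quot) : adjp.unit.app ((τm ⋙ P.ιMinus).obj A) ≫ η A =
    (τm ⋙ P.ιMinus).map (adjp.unit.app A) := hη A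
  -- A second description of `η`, by the counit: this one yields mono, the unit equation `hη` yields
  -- epi.
  have h₁ (A : P.Quot) : η A ≫ adjm.counit.app ((τp ⋙ P.ιPlus).obj A) =
      (τp ⋙ P.ιPlus).map (adjm.counit.app A) := (hu A _ (τp.obj A).property).1 (by
    change adjp.unit.app ((τm ⋙ P.ιMinus).obj A) ≫ η A ≫ _ =
      adjp.unit.app ((τm ⋙ P.ιMinus).obj A) ≫ _
    rw [← Category.assoc, hη]
    exact (adjm.counit.naturality (adjp.unit.app A)).trans
      (adjp.unit.naturality (adjm.counit.app A)))
  have (A : P.Quot) : IsIso (η A) := by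
    let f : (⟨_, (τp.obj _).property, hm A⟩ : P.Heart) ⟶ ⟨_, hp A, (τm.obj _).property⟩ :=
      ObjectProperty.homMk (η A)
    have : Mono f := (Preadditive.mono_iff_cancel_zero f).2 fun K k hk ↦
      ObjectProperty.hom_ext _ (eq_zero_of_reflection (isLocal_unit adjp A) (τp.obj A).property
        (isColocal_counit adjm A) (τm.obj A).property (hu A) (τp.obj _).property
        (adjp.unit.naturality (adjm.counit.app A)).symm K.property.2 k.hom (by
          rw [← h₁, ← Category.assoc]
          exact (congrArg (· ≫ _) (P.ιHeart.congr_map hk)).trans zero_comp))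
    have : Epi f := (Preadditive.epi_iff_cancel_zero f).2 fun K k hk ↦
      ObjectProperty.hom_ext _ (eq_zero_of_coreflection (isLocal_unit adjp A) (τp.obj A).property
        (isColocal_counit adjm A) (τm.obj A).property (isColocal_counit adjm _)
        (τm.obj _).property (adjm.counit.naturality (adjp.unit.app A)) K.property.1 k.hom (by
          rw [← hη, Category.assoc]
          exact (congrArg (_ ≫ ·) (P.ιHeart.congr_map hk)).trans comp_zero))
    have : IsIso f := isIso_of_mono_of_epi f
    exact P.ιHeart.map_isIso f
  refine ⟨NatIso.ofComponents (fun A ↦ asIso (η A)) fun {A B} f ↦ ?_, fun A ↦ hη A⟩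
  apply (hu A _ (hp B)).1
  change adjp.unit.app ((τm ⋙ P.ιMinus).obj A) ≫
      (τp ⋙ P.ιPlus).map ((τm ⋙ P.ιMinus).map f) ≫ η B =
    adjp.unit.app ((τm ⋙ P.ιMinus).obj A) ≫ η A ≫
      (τm ⋙ P.ιMinus).map ((τp ⋙ P.ιPlus).map f)
  rw [← Category.assoc, ← Category.assoc, hη, ← Functor.map_comp]
  have h₂ := adjp.unit.naturality ((τm ⋙ P.ιMinus).map f)
  have h₃ := adjp.unit.naturality f
  refine (congrArg (· ≫ η B) h₂.symm).trans ((Category.assoc _ _ _).trans ?_)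
  refine (congrArg (_ ≫ ·) (hη B)).trans ?_
  exact ((τm ⋙ P.ιMinus).map_comp _ _).symm.trans (congrArg (τm ⋙ P.ιMinus).map h₃)

end Commutation

/-! ### Existence, additivity and exactness of `H`. -/

section Homological

variable {C : Type u} [Category.{v} C] [Preadditive C] [HasZeroObject C] [HasShift C ℤ]
  [∀ n : ℤ, (shiftFunctor C n).Additive] [Pretriangulated C] {P : TorsionPair C}

/-- Exactness in the middle of a distinguished triangle `A ⟶ M ⟶ D`, tested on a morphism from
an object of `C⁻` and a morphism to an object of `C⁺`. -/
lemma π_comp_eq_zero {A M D K Q : C} {f : A ⟶ M} {g : M ⟶ D} {h : D ⟶ A⟦(1 : ℤ)⟧}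
    (hT : Triangle.mk f g h ∈ distTriang C) (hK : P.minus K) (hQ : P.plus Q) (k : K ⟶ M)
    (q : M ⟶ Q) (hq : ∀ (X : C) (x : X ⟶ A), P.X X → x ≫ f ≫ q = 0)
    (hk : ∀ (V : C) (v : D ⟶ V), P.Y₁ V → k ≫ g ≫ v = 0) : P.π.map (k ≫ q) = 0 := by
  obtain ⟨X, Y, i, p, _, hX, hY, hA⟩ := P.exists_triangle A
  obtain ⟨y, hy⟩ := exists_desc₂ hA (f ≫ q) (hq X i hX)
  obtain ⟨Y', U, _, u, t, hY', hU, hD⟩ := P.exists_triangle₁ D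
  obtain ⟨s, hs⟩ := exists_lift₃ hD (k ≫ g) (by
    rw [Category.assoc, hk _ t (Y₁_shift hY')])
  -- `E` is a homotopy pullback of `M ⟶ D` along `U ⟶ D`; `k` lifts to `E`, and `A ⟶ Y` extends to
  -- `E` because `U` has no maps to `Y[1]`.
  obtain ⟨E, a, b, hE⟩ := distinguished_cocone_triangle₂ (u ≫ h)
  obtain ⟨m, ham, hmg⟩ : ∃ m : E ⟶ M, a ≫ m = f ∧ b ≫ u = m ≫ g := by
    obtain ⟨m, h₁, h₂⟩ := complete_distinguished_triangle_morphism₂ _ _ hE hT (𝟙 A) u (by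
      change (u ≫ h) ≫ (𝟙 A)⟦(1 : ℤ)⟧' = u ≫ h
      rw [CategoryTheory.Functor.map_id, Category.comp_id])
    exact ⟨m, h₁.trans (Category.id_comp _), h₂⟩
  obtain ⟨s', rfl⟩ := exists_lift₃ hE s (by
    rw [← Category.assoc, ← hs, Category.assoc, dist_zero₂₃ hT, comp_zero])
  obtain ⟨l, hl⟩ := exists_lift₂ hT (s' ≫ m - k) (by
    rw [Preadditive.sub_comp, hs, Category.assoc, Category.assoc, hmg, sub_self])
  have hk' : k = (s' - l ≫ a) ≫ m := by
    rw [Preadditive.sub_comp, Category.assoc, ham, ← hl, sub_sub_cancel]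
  obtain ⟨p', rfl⟩ := exists_desc₁ hE p (zero₁ hU (Y₁_shift hY) _)
  obtain ⟨u', hu'⟩ := exists_desc₂ hE (m ≫ q - p' ≫ y) (by
    rw [Preadditive.comp_sub, ← Category.assoc, ham, hy, Category.assoc, sub_self])
  -- Now `k ≫ q` is a sum of a map through `Y` and a map through `U`. The first factors through `W`
  -- because `K ∈ C⁻`, the second because `Q ∈ C⁺`.
  obtain ⟨W, c, d, hW, hcd⟩ := minus_factor hK hY ((s' - l ≫ a) ≫ p')
  obtain ⟨W', c', d', hW', rfl⟩ := plus_factor hQ hU u'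
  rw [hk', Category.assoc, ← sub_add_cancel (m ≫ q) (p' ≫ y), hu', Preadditive.comp_add,
    P.π.map_add, ← Category.assoc _ p', hcd, ← Category.assoc b, ← Category.assoc _ (b ≫ c'),
    π_map_eq_zero hW', Category.assoc, π_map_eq_zero hW, add_zero]

lemma IsHeartFunctor.additive {H : C ⥤ P.Heart} (h : P.IsHeartFunctor H) : H.Additive := by
  obtain ⟨τp, adjp, τm, adjm, ⟨e⟩⟩ := h
  have := adjp.left_adjoint_additive
  have := adjm.right_adjoint_additive
  have : (H ⋙ P.ιHeart).Additive := Functor.additive_of_iso e.symm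
  exact Functor.additive_of_comp_faithful H P.ιHeart

variable [IsTriangulated C]

/-- The object `M`, a reflection of the coreflection `B₀` of `B`, represents `LR(B)`. It sits in a
triangle on `A₀ ⟶ M`, with `A₀` the fibre of `B₀ ⟶ D`; the conditions of `π_comp_eq_zero` for this
triangle follow from `hk` and `hq`. -/
lemma comp_eq_zero_of_triangle {L R : P.Quot ⥤ P.Quot} (ρ : 𝟭 _ ⟶ L) (ε : R ⟶ 𝟭 _)
    (hL : ∀ A, P.bar P.plus (L.obj A)) (hR : ∀ A, P.bar P.minus (R.obj A))
    (hρ : ∀ A, (P.bar P.plus).isLocal (ρ.app A)) (hε : ∀ A, (P.bar P.minus).isColocal (ε.app A))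
    {A B D : C} {f : A ⟶ B} {g : B ⟶ D} {h : D ⟶ A⟦(1 : ℤ)⟧}
    (hT : Triangle.mk f g h ∈ distTriang C) {K Q : P.Quot} (hK : P.bar P.minus K)
    (hQ : P.bar P.plus Q) (k : K ⟶ L.obj (R.obj (P.π.obj B)))
    (q : L.obj (R.obj (P.π.obj B)) ⟶ Q) (hk : k ≫ L.map (R.map (P.π.map g)) = 0)
    (hq : L.map (R.map (P.π.map f)) ≫ q = 0) : k ≫ q = 0 := by
  obtain ⟨Y, V, B₀, i, r, s, b, hY, hV, hB₀, hT₁⟩ := P.exists_coreflection B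
  obtain ⟨A₀, j, t, hT₂⟩ := distinguished_cocone_triangle₁ (r ≫ g)
  obtain ⟨α, hα⟩ := exists_lift₂ hT (j ≫ r) (by rw [Category.assoc, dist_zero₁₂ hT₂])
  obtain ⟨X, U, M, c, d, m, h', hX, hU, hM, hT₃⟩ := P.exists_reflection B₀
  obtain ⟨D', γ, t', hT₄⟩ := distinguished_cocone_triangle (j ≫ m)
  obtain ⟨δ, hδ⟩ := exists_desc₂ hT₂ (m ≫ γ) (by rw [← Category.assoc, dist_zero₁₂ hT₄])
  have hm := isLocal_of_triangle hT₃ hX hU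
  obtain ⟨e₂, he₂⟩ := exists_iso_of_isColocal (hε (P.π.obj B)) (isColocal_of_triangle hT₁ hY hV)
    (hR _) hB₀
  obtain ⟨e₃, he₃⟩ := exists_iso_of_isLocal hm
    ((P.bar P.plus).isLocal.comp_mem _ _ ((P.bar P.plus).isLocal_of_isIso e₂.hom)
      (hρ (R.obj (P.π.obj B)))) hM (hL _)
  obtain ⟨q₀, hq₀⟩ := exists_π_map (e₃.hom ≫ q)
  obtain ⟨k₀, hk₀⟩ := exists_π_map (k ≫ e₃.inv)
  have key : P.π.map (k₀ ≫ q₀) = 0 := by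
    refine π_comp_eq_zero hT₄ hK hQ k₀ q₀ (fun X x hX ↦ eq_zero_of_X hX _ ?_)
      (fun V v hV ↦ eq_zero_of_Y₁ hV _ ?_)
    -- Objects of `X` lie in `C⁻`, so in `C/W` the map to `A` lifts to `R(A)`, where `hq` applies.
    · obtain ⟨w, hw⟩ := (hε (P.π.obj A) (P.π.obj X) (minus_of_X hX)).2 (P.π.map (x ≫ α))
      replace hw : w ≫ ε.app _ = P.π.map (x ≫ α) := hw
      have h₁ : P.π.map (x ≫ j) ≫ e₂.hom = w ≫ R.map (P.π.map f) :=
        (hε (P.π.obj B) (P.π.obj X) (minus_of_X hX)).1 (by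
          change (P.π.map (x ≫ j) ≫ e₂.hom) ≫ ε.app _ = (w ≫ R.map (P.π.map f)) ≫ ε.app _
          rw [Category.assoc, he₂, Category.assoc, ε.naturality, ← Category.assoc w, hw,
            ← P.π.map_comp, Category.assoc, hα, ← Category.assoc, P.π.map_comp]
          rfl)
      rw [Category.assoc, ← Category.assoc x, ← Category.assoc, P.π.map_comp, hq₀, P.π.map_comp,
        Category.assoc, reassoc_of% he₃, reassoc_of% h₁]
      have h₂ := ρ.naturality (R.map (P.π.map f))
      dsimp at h₂
      rw [reassoc_of% h₂, hq, comp_zero, comp_zero]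
    -- Objects of `Y[1]` lie in `C⁺`, so in `C/W` the map from `D` extends to `L(D)`, where `hk`
    -- applies.
    · obtain ⟨z, hz⟩ := (hρ (P.π.obj D) (P.π.obj V) (plus_of_Y₁ hV)).2 (P.π.map (δ ≫ v))
      replace hz : ρ.app _ ≫ z = P.π.map (δ ≫ v) := hz
      have h₁ : P.π.map (γ ≫ v) =
          e₃.hom ≫ L.map (ε.app (P.π.obj B)) ≫ L.map (P.π.map g) ≫ z :=
        (hm (P.π.obj V) (plus_of_Y₁ hV)).1 (by
          change P.π.map m ≫ P.π.map (γ ≫ v) = P.π.map m ≫ e₃.hom ≫ _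
          have h₂ := ρ.naturality (ε.app (P.π.obj B))
          have h₃ := ρ.naturality (P.π.map g)
          dsimp at h₂ h₃
          rw [reassoc_of% he₃, ← reassoc_of% h₂, ← reassoc_of% h₃, hz, reassoc_of% he₂,
            ← P.π.map_comp, ← P.π.map_comp, ← P.π.map_comp, ← Category.assoc, hδ]
          simp only [Category.assoc])
      rw [P.π.map_comp, hk₀, h₁, Category.assoc, e₃.inv_hom_id_assoc]
      have h₂ := ε.naturality (P.π.map g)
      dsimp at h₂
      rw [← L.map_comp_assoc, ← h₂, L.map_comp_assoc, reassoc_of% hk, zero_comp]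
  rw [P.π.map_comp, hk₀, hq₀] at key
  simpa using key

lemma isRightAdjoint_ιPlus : P.ιPlus.IsRightAdjoint :=
  isRightAdjoint_ι_of_isLocal exists_isLocal

lemma isLeftAdjoint_ιMinus : P.ιMinus.IsLeftAdjoint :=
  isLeftAdjoint_ι_of_isColocal exists_isColocal

variable (P) in
lemma exists_isHeartFunctor : ∃ H : C ⥤ P.Heart, P.IsHeartFunctor H := by
  have := P.isRightAdjoint_ιPlus
  have := P.isLeftAdjoint_ιMinus
  have adjp := Adjunction.ofIsRightAdjoint P.ιPlus
  have adjm := Adjunction.ofIsLeftAdjoint P.ιMinus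
  exact ⟨ObjectProperty.lift _
    (P.π ⋙ (P.ιMinus.rightAdjoint ⋙ P.ιMinus) ⋙ (P.ιPlus.leftAdjoint ⋙ P.ιPlus))
    fun A ↦ ⟨(P.ιPlus.leftAdjoint.obj _).property,
      bar_minus_of_minus adjp (P.ιMinus.rightAdjoint.obj _).property⟩,
    _, adjp, _, adjm, ⟨Iso.refl _⟩⟩

lemma IsHeartFunctor.isHomological {H : C ⥤ P.Heart} (h : P.IsHeartFunctor H) :
    let _ := abelianHeart P
    H.IsHomological := by
  let _ := abelianHeart P
  have := h.additive
  obtain ⟨τp, adjp, τm, adjm, ⟨e⟩⟩ := h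
  refine { exact := fun T hT ↦ ?_ }
  rw [ShortComplex.exact_iff_kernel_ι_comp_cokernel_π_zero]
  have hk : kernel.ι (H.map T.mor₂) ≫ H.map T.mor₂ = 0 := kernel.condition _
  have hq : H.map T.mor₁ ≫ cokernel.π (H.map T.mor₁) = 0 := cokernel.condition _
  replace hk := P.ιHeart.congr_map hk
  replace hq := P.ιHeart.congr_map hq
  rw [Functor.map_comp, Functor.map_zero] at hk hq
  apply P.ιHeart.map_injective
  have key := comp_eq_zero_of_triangle (L := τp ⋙ P.ιPlus) (R := τm ⋙ P.ιMinus) adjp.unit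
    adjm.counit (fun A ↦ (τp.obj A).property) (fun A ↦ (τm.obj A).property) (isLocal_unit adjp)
    (isColocal_counit adjm) (f := T.mor₁) (g := T.mor₂) (h := T.mor₃) hT
    (kernel (H.map T.mor₂)).property.2 (cokernel (H.map T.mor₁)).property.1
    (P.ιHeart.map (kernel.ι (H.map T.mor₂)) ≫ e.hom.app _)
    (e.inv.app _ ≫ P.ιHeart.map (cokernel.π (H.map T.mor₁))) (by
      have := e.hom.naturality T.mor₂
      rw [Category.assoc]
      refine (congrArg (_ ≫ ·) this.symm).trans ?_
      rw [← Category.assoc]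
      exact (congrArg (· ≫ _) hk).trans zero_comp) (by
      have := e.inv.naturality T.mor₁
      rw [← Category.assoc]
      refine (congrArg (· ≫ _) this).trans ?_
      rw [Category.assoc]
      exact (congrArg (_ ≫ ·) hq).trans comp_zero)
  rw [Category.assoc, e.hom_inv_id_app_assoc, ← Functor.map_comp] at key
  exact key.trans (P.ιHeart.map_zero _ _).symm

end Homological

/-! ### Comparing reflectors with explicit functors. -/

section AdjointIso

variable {D E : Type*} [Category* D] [Category* E] {S : ObjectProperty D}

/-- A natural family of reflections computes the reflector. -/
lemma nonempty_iso_of_isLocal {L : D ⥤ S.FullSubcategory} (adj : L ⊣ S.ι) {G F : E ⥤ D}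
    (α : G ⟶ F) (hF : ∀ A, S (F.obj A)) (hα : ∀ A, S.isLocal (α.app A)) :
    Nonempty (G ⋙ L ⋙ S.ι ≅ F) := by
  choose e he using fun A ↦ exists_iso_of_isLocal (isLocal_unit adj (G.obj A)) (hα A)
    (L.obj _).property (hF A)
  refine ⟨NatIso.ofComponents e fun {A B} f ↦ (isLocal_unit adj (G.obj A) _ (hF B)).1 ?_⟩
  have h := adj.unit.naturality (G.map f)
  change adj.unit.app (G.obj A) ≫ (L ⋙ S.ι).map (G.map f) ≫ (e B).hom =
    adj.unit.app (G.obj A) ≫ (e A).hom ≫ F.map f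
  rw [← Category.assoc, ← Category.assoc, he, ← α.naturality, ← he B, ← Category.assoc]
  exact congrArg (· ≫ _) h.symm

/-- A natural family of coreflections computes the coreflector. -/
lemma nonempty_iso_of_isColocal {R : D ⥤ S.FullSubcategory} (adj : S.ι ⊣ R) {G F : E ⥤ D}
    (α : F ⟶ G) (hF : ∀ A, S (F.obj A)) (hα : ∀ A, S.isColocal (α.app A)) :
    Nonempty (G ⋙ R ⋙ S.ι ≅ F) := by
  choose e he using fun A ↦ exists_iso_of_isColocal (hα A) (isColocal_counit adj (G.obj A))
    (hF A) (R.obj _).property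
  refine ⟨NatIso.ofComponents e fun {A B} f ↦ (hα B _ (R.obj _).property).1 ?_⟩
  have h := adj.counit.naturality (G.map f)
  change ((R ⋙ S.ι).map (G.map f) ≫ (e B).hom) ≫ α.app B =
    ((e A).hom ≫ F.map f) ≫ α.app B
  rw [Category.assoc, Category.assoc, he, α.naturality, reassoc_of% he A]
  exact h

end AdjointIso

lemma prop_of_iso_of_isClusterTilting {C : Type u} [Category.{v} C] [Preadditive C]
    [HasShift C ℤ] {T : ObjectProperty C} (hT : IsClusterTilting T)
    {A B : C} (e : A ≅ B) (hA : T A) : T B :=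
  (hT.iff_left B).2 fun T₀ f h ↦ by
    rw [← cancel_epi e.hom, comp_zero]
    exact (hT.iff_left A).1 hA T₀ _ h

/-! ### Torsion pairs from orthogonal subcategories. -/

section Constructors

variable {C : Type u} [Category.{v} C] [Preadditive C] [HasZeroObject C] [HasShift C ℤ]
  [∀ n : ℤ, (shiftFunctor C n).Additive] [Pretriangulated C]

lemma isClosedUnderFiniteProducts_of_biprod (S : ObjectProperty C) [S.ContainsZero]
    [S.IsClosedUnderIsomorphisms] (h : ∀ A B, S A → S B → S (A ⊞ B)) :
    S.IsClosedUnderFiniteProducts := by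
  have : S.IsClosedUnderBinaryProducts := .mk' (by
    rintro _ ⟨F, hF⟩
    exact S.prop_of_iso ((biprod.isoProd _ _).trans
      (HasLimit.isoOfNatIso (diagramIsoPair F)).symm) (h _ _ (hF _) (hF _)))
  exact .mk'

/-- Two mutually orthogonal subcategories with approximation triangles form a torsion pair. -/
def ofOrthogonal (X Y : ObjectProperty C)
    (hX : ∀ A, X A ↔ ∀ (B : C) (f : A ⟶ B), Y B → f = 0)
    (hY : ∀ A, Y A ↔ ∀ (B : C) (f : B ⟶ A), X B → f = 0)
    (h : ∀ A : C, ∃ (A' A'' : C) (f : A' ⟶ A) (g : A ⟶ A'') (h : A'' ⟶ A'⟦(1 : ℤ)⟧),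
      X A' ∧ Y A'' ∧ Triangle.mk f g h ∈ distTriang C) : TorsionPair C :=
  have hX' : X.IsStableUnderRetracts := ⟨fun {A B} r hB ↦ (hX A).2 fun D f hD ↦ by
    rw [← Category.id_comp f, ← r.retract, Category.assoc, (hX B).1 hB D (r.r ≫ f) hD, comp_zero]⟩
  have hY' : Y.IsStableUnderRetracts := ⟨fun {A B} r hB ↦ (hY A).2 fun D f hD ↦ by
    rw [← Category.comp_id f, ← r.retract, ← Category.assoc, (hY B).1 hB D (f ≫ r.i) hD, zero_comp]⟩
  have : X.ContainsZero := ⟨0, isZero_zero C, (hX 0).2 fun _ _ _ ↦ (isZero_zero C).eq_of_src _ _⟩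
  have : Y.ContainsZero := ⟨0, isZero_zero C, (hY 0).2 fun _ _ _ ↦ (isZero_zero C).eq_of_tgt _ _⟩
  { X := X
    Y := Y
    additive_X := isClosedUnderFiniteProducts_of_biprod X fun A B hA hB ↦ (hX _).2 fun D f hD ↦ by
      apply biprod.hom_ext'
      · rw [(hX A).1 hA D (biprod.inl ≫ f) hD, comp_zero]
      · rw [(hX B).1 hB D (biprod.inr ≫ f) hD, comp_zero]
    additive_Y := isClosedUnderFiniteProducts_of_biprod Y fun A B hA hB ↦ (hY _).2 fun D f hD ↦ by
      apply biprod.hom_ext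
      · rw [(hY A).1 hA D (f ≫ biprod.fst) hD, zero_comp]
      · rw [(hY B).1 hB D (f ≫ biprod.snd) hD, zero_comp]
    thick_X := hX'
    thick_Y := hY'
    zero := fun A B f hA hB ↦ (hX A).1 hA B f hB
    exists_triangle := h }

/-- The torsion pair `(C^{≤ 0}, C^{≥ 1})` of a t-structure. -/
def ofTStructure (t : TStructure C) : TorsionPair C :=
  ofOrthogonal (t.le 0) (t.ge 1)
    (fun A ↦ by simpa using t.isLE_iff_orthogonal 0 1 rfl A)
    (fun A ↦ by simpa using t.isGE_iff_orthogonal 0 1 rfl A)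
    (fun A ↦ by
      obtain ⟨X, Y, hX, hY, f, g, h, hT⟩ := t.exists_triangle A 0 1 rfl
      exact ⟨X, Y, f, g, h, hX, hY, hT⟩)

/-! ### The t-structure case. -/

section TStructure

variable (t : TStructure C)

lemma ofTStructure_X₁ (A : C) : (ofTStructure t).X₁ A ↔ t.IsLE A (-1) :=
  (t.le_iff_isLE _ _).trans (t.isLE_shift_iff A (-1) (-1) 0)

lemma ofTStructure_Y₁ (A : C) : (ofTStructure t).Y₁ A ↔ t.IsGE A 0 :=
  (t.ge_iff_isGE _ _).trans (t.isGE_shift_iff A 0 (-1) 1)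

lemma ofTStructure_plus : (ofTStructure t).plus = t.ge 0 := by
  ext A
  constructor
  · intro hA
    refine (t.ge_iff_isGE _ _).2 ((t.isGE_iff_orthogonal (-1) 0 rfl A).2 fun Y f hY ↦ ?_)
    have hX : (ofTStructure t).X Y := (t.isLE_of_le Y (-1) 0).le
    -- An object of `C^{≤ -1}` lies in both `X` and `X[1]`, so its identity may serve as the first
    -- map of the test composite.
    rw [← Category.id_comp f, plus_comp_zero hA ((ofTStructure_X₁ t Y).2 hY) hX (𝟙 Y) f]
  · intro hA
    have : t.IsGE A 0 := ⟨hA⟩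
    refine plus_of_forall fun B D g f hB _ ↦ ?_
    have : t.IsLE B (-1) := (ofTStructure_X₁ t B).1 hB
    rw [t.zero f (-1) 0, comp_zero]

lemma ofTStructure_minus : (ofTStructure t).minus = t.le 0 := by
  ext A
  constructor
  · intro hA
    refine (t.le_iff_isLE _ _).2 ((t.isLE_iff_orthogonal 0 1 rfl A).2 fun Y f hY ↦ ?_)
    have hY' : (ofTStructure t).Y₁ Y := (ofTStructure_Y₁ t Y).2 (t.isGE_of_ge Y 0 1)
    rw [← Category.comp_id f, minus_comp_zero hA hY.ge hY' f (𝟙 Y)]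
  · intro hA
    have : t.IsLE A 0 := ⟨hA⟩
    refine minus_of_forall fun B D f g hB _ ↦ ?_
    have : t.IsGE B 1 := ⟨hB⟩
    rw [t.zero f 0 1, zero_comp]

lemma ofTStructure_isZero_W {A : C} (hA : (ofTStructure t).W A) : IsZero A := by
  have : t.IsLE A (-1) := (ofTStructure_X₁ t A).1 hA.1
  have : t.IsGE A 1 := ⟨hA.2⟩
  exact t.isZero A (-1) 1

instance faithful_π_ofTStructure : (ofTStructure t).π.Faithful where
  map_injective {A B} f g hfg := by
    rw [← sub_eq_zero, ← Functor.map_sub] at hfg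
    obtain ⟨D, a, b, hD, h⟩ := (π_map_eq_zero_iff _).1 hfg
    rw [← sub_eq_zero, h, (ofTStructure_isZero_W t hD).eq_of_tgt a 0, zero_comp]

instance isEquivalence_π_ofTStructure : (ofTStructure t).π.IsEquivalence where
  full := Quotient.full_functor _
  essSurj := Quotient.essSurj_functor _

/-- The truncation maps already have the universal properties in `C`, and `π` is full and faithful.
-/
lemma nonempty_iso_ofTStructure [IsTriangulated C] {H : C ⥤ (ofTStructure t).Heart}
    (h : (ofTStructure t).IsHeartFunctor H) :
    Nonempty (H ⋙ (ofTStructure t).ιHeart ≅ t.truncGELE 0 0 ⋙ (ofTStructure t).π) := by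
  obtain ⟨τp, adjp, τm, adjm, ⟨e⟩⟩ := h
  obtain ⟨e₁⟩ := nonempty_iso_of_isColocal adjm
    (Functor.whiskerRight (t.truncLEι 0) (ofTStructure t).π)
    (fun A ↦ by
      change (ofTStructure t).minus ((t.truncLE 0).obj A)
      rw [ofTStructure_minus]
      exact t.le_of_isLE _ _)
    (fun A Z hZ ↦ by
      have hZ : (ofTStructure t).minus Z.as := hZ
      rw [ofTStructure_minus] at hZ
      have : t.IsLE Z.as 0 := ⟨hZ⟩
      constructor
      · intro f g hfg
        obtain ⟨f, rfl⟩ := exists_π_map f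
        obtain ⟨g, rfl⟩ := exists_π_map g
        have hfg : (ofTStructure t).π.map (f ≫ (t.truncLEι 0).app A) =
          (ofTStructure t).π.map (g ≫ (t.truncLEι 0).app A) := hfg
        exact congrArg _ (t.to_truncLE_obj_ext ((ofTStructure t).π.map_injective hfg))
      · intro f
        obtain ⟨f, rfl⟩ := exists_π_map f
        exact ⟨(ofTStructure t).π.map (t.liftTruncLE f 0),
          congrArg (ofTStructure t).π.map (t.liftTruncLE_ι f 0)⟩)
  obtain ⟨e₂⟩ := nonempty_iso_of_isLocal adjp
    (Functor.whiskerRight (t.truncGEπ 0) (ofTStructure t).π)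
    (fun A ↦ by
      change (ofTStructure t).plus ((t.truncGE 0).obj A)
      rw [ofTStructure_plus]
      exact t.ge_of_isGE _ _)
    (fun A Z hZ ↦ by
      have hZ : (ofTStructure t).plus Z.as := hZ
      rw [ofTStructure_plus] at hZ
      have : t.IsGE Z.as 0 := ⟨hZ⟩
      constructor
      · intro f g hfg
        obtain ⟨f, rfl⟩ := exists_π_map f
        obtain ⟨g, rfl⟩ := exists_π_map g
        have hfg : (ofTStructure t).π.map ((t.truncGEπ 0).app A ≫ f) =
          (ofTStructure t).π.map ((t.truncGEπ 0).app A ≫ g) := hfg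
        exact congrArg _ (t.from_truncGE_obj_ext ((ofTStructure t).π.map_injective hfg))
      · intro f
        obtain ⟨f, rfl⟩ := exists_π_map f
        exact ⟨(ofTStructure t).π.map (t.descTruncGE f 0),
          congrArg (ofTStructure t).π.map (t.π_descTruncGE f 0)⟩)
  exact ⟨e ≪≫ Functor.isoWhiskerRight e₁ (τp ⋙ (ofTStructure t).ιPlus) ≪≫
    Functor.isoWhiskerLeft (t.truncLE 0) e₂⟩

end TStructure

/-! ### The cluster tilting case. -/

section ClusterTilting

variable {T : ObjectProperty C}

/-- The torsion pair `(T[-1], T)` of a cluster tilting subcategory. -/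
def ofClusterTilting (hT : IsClusterTilting T) : TorsionPair C :=
  ofOrthogonal (T.shift (1 : ℤ)) T
    (fun A ↦ by
      refine (hT.iff_left _).trans ⟨fun h B f hB ↦ (shiftFunctor C (1 : ℤ)).map_injective ?_,
        fun h B f hB ↦ ?_⟩
      · rw [h B (f⟦(1 : ℤ)⟧') hB, Functor.map_zero]
      · obtain ⟨f, rfl⟩ := (shiftFunctor C (1 : ℤ)).map_surjective f
        rw [h B f hB, Functor.map_zero])
    (fun A ↦ by
      refine (hT.iff_right _).trans ⟨fun h B f hB ↦ (shiftFunctor C (1 : ℤ)).map_injective ?_,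
        fun h B f hB ↦ ?_⟩
      · rw [h _ (f⟦(1 : ℤ)⟧') hB, Functor.map_zero]
      · let e : B⟦(-1 : ℤ)⟧⟦(1 : ℤ)⟧ ≅ B := (shiftEquiv C (1 : ℤ)).counitIso.app B
        rw [← cancel_epi e.hom, comp_zero]
        obtain ⟨g, hg⟩ := (shiftFunctor C (1 : ℤ)).map_surjective (e.hom ≫ f)
        rw [← hg, h _ g (prop_of_iso_of_isClusterTilting hT e.symm hB), Functor.map_zero])
    (fun A ↦ by
      -- Wakamatsu's argument: a map `A'⟦1⟧ ⟶ T₁⟦1⟧` vanishes on `T₀`, so it comes from a map `A ⟶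
      -- T₁`; this factors through the approximation `i`, which `f` kills.
      obtain ⟨T₀, i, hT₀, hi⟩ := hT.covariantlyFinite A
      obtain ⟨A', f, h, hA⟩ := distinguished_cocone_triangle₁ i
      refine ⟨A', T₀, f, i, h, (hT.iff_left _).2 fun T₁ k hT₁ ↦ ?_, hT₀, hA⟩
      obtain ⟨l, rfl⟩ := exists_desc₃ (rotate_dist hA) k ((hT.iff_left _).1 hT₀ T₁ _ hT₁)
      obtain ⟨l, rfl⟩ := (shiftFunctor C (1 : ℤ)).map_surjective l
      obtain ⟨g, rfl⟩ := hi T₁ l hT₁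
      rw [Preadditive.neg_comp, ← Functor.map_comp, ← Category.assoc, dist_zero₁₂ hA, zero_comp,
        Functor.map_zero, neg_zero])

variable (hT : IsClusterTilting T)

lemma ofClusterTilting_X₁ {A : C} : (ofClusterTilting hT).X₁ A ↔ T A :=
  ⟨prop_of_iso_of_isClusterTilting hT ((shiftEquiv C (1 : ℤ)).counitIso.app A),
    prop_of_iso_of_isClusterTilting hT ((shiftEquiv C (1 : ℤ)).counitIso.app A).symm⟩

lemma ofClusterTilting_W : (ofClusterTilting hT).W = T := by
  ext A
  exact ⟨fun h ↦ h.2, fun h ↦ ⟨(ofClusterTilting_X₁ hT).2 h, h⟩⟩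

/-- Here `X[1] = T = Y`, so the first map of every test composite is already zero. -/
lemma ofClusterTilting_plus : (ofClusterTilting hT).plus = ⊤ := by
  ext A
  refine ⟨fun _ ↦ trivial, fun _ ↦ plus_of_forall fun U X g f hU hX ↦ ?_⟩
  rw [(ofClusterTilting hT).zero g hX ((ofClusterTilting_X₁ hT).1 hU), zero_comp]

lemma ofClusterTilting_minus : (ofClusterTilting hT).minus = ⊤ := by
  ext A
  refine ⟨fun _ ↦ trivial, fun _ ↦ minus_of_forall fun Y V f g hY hV ↦ ?_⟩
  rw [zero₁ ((ofClusterTilting_X₁ hT).2 hY) hV g, comp_zero]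

lemma ofClusterTilting_bar_plus (A : (ofClusterTilting hT).Quot) :
    (ofClusterTilting hT).bar (ofClusterTilting hT).plus A := by
  rw [ofClusterTilting_plus]
  trivial

lemma ofClusterTilting_bar_minus (A : (ofClusterTilting hT).Quot) :
    (ofClusterTilting hT).bar (ofClusterTilting hT).minus A := by
  rw [ofClusterTilting_minus]
  trivial

lemma isEquivalence_ιHeart_ofClusterTilting : (ofClusterTilting hT).ιHeart.IsEquivalence where
  essSurj := ⟨fun A ↦ ⟨⟨A, ofClusterTilting_bar_plus hT A, ofClusterTilting_bar_minus hT A⟩,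
    ⟨Iso.refl _⟩⟩⟩

lemma nonempty_iso_ofClusterTilting {H : C ⥤ (ofClusterTilting hT).Heart}
    (h : (ofClusterTilting hT).IsHeartFunctor H) :
    Nonempty (H ⋙ (ofClusterTilting hT).ιHeart ≅ (ofClusterTilting hT).π) := by
  obtain ⟨τp, adjp, τm, adjm, ⟨e⟩⟩ := h
  obtain ⟨e₁⟩ := nonempty_iso_of_isColocal adjm (𝟙 (ofClusterTilting hT).π)
    (fun A ↦ ofClusterTilting_bar_minus hT _)
    (fun A ↦ ObjectProperty.isColocal_of_isIso _ (𝟙 _))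
  obtain ⟨e₂⟩ := nonempty_iso_of_isLocal adjp (𝟙 (ofClusterTilting hT).π)
    (fun A ↦ ofClusterTilting_bar_plus hT _)
    (fun A ↦ ObjectProperty.isLocal_of_isIso _ (𝟙 _))
  exact ⟨e ≪≫ Functor.isoWhiskerRight e₁ (τp ⋙ (ofClusterTilting hT).ιPlus) ≪≫ e₂⟩

end ClusterTilting

end Constructors

end TorsionPair

theorem mainTheorem1 {C : Type u} [Category.{v} C] [Preadditive C] [HasZeroObject C]
    [HasShift C ℤ] [∀ n : ℤ, (shiftFunctor C n).Additive] [Pretriangulated C]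
    [IsTriangulated C] :
    -- for every torsion pair:
    (∀ P : TorsionPair C,
      -- the adjoints `τ⁺` and `τ⁻` exist,
      P.ιPlus.IsRightAdjoint ∧ P.ιMinus.IsLeftAdjoint ∧
      -- `τ⁺τ⁻ ≅ τ⁻τ⁺`, compatibly with the units of `τ⁺`,
      (∀ (τp : P.Quot ⥤ P.Plus) (adjp : τp ⊣ P.ιPlus)
        (τm : P.Quot ⥤ P.Minus) (_ : P.ιMinus ⊣ τm),
        ∃ η : (τm ⋙ P.ιMinus) ⋙ (τp ⋙ P.ιPlus) ≅ (τp ⋙ P.ιPlus) ⋙ (τm ⋙ P.ιMinus),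
          ∀ A : P.Quot,
            adjp.unit.app ((τm ⋙ P.ιMinus).obj A) ≫ η.hom.app A =
              (τm ⋙ P.ιMinus).map (adjp.unit.app A)) ∧
      -- the functor `H` from `C` to the heart exists and is additive,
      (∃ H : C ⥤ P.Heart, P.IsHeartFunctor H) ∧
      (∀ H : C ⥤ P.Heart, P.IsHeartFunctor H → H.Additive) ∧
      -- and the heart, with its given additive structure, is abelian and `H` is cohomological
      ∃ hA : Abelian P.Heart,
        hA.toPreadditive = Preadditive.fullSubcategory (P.bar (P.plus ⊓ P.minus)) ∧
        ∀ H : C ⥤ P.Heart, P.IsHeartFunctor H → H.IsHomological) ∧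
    -- every t-structure is a torsion pair, and then `C/W` is `C`, the heart is the heart of the
    -- t-structure and `H` is its zeroth cohomology functor
    (∀ t : TStructure C, ∃ P : TorsionPair C, P.X = t.le 0 ∧ P.Y = t.ge 1 ∧
      P.π.IsEquivalence ∧ P.plus = t.ge 0 ∧ P.minus = t.le 0 ∧ P.plus ⊓ P.minus = t.heart ∧
      ∀ H : C ⥤ P.Heart, P.IsHeartFunctor H →
        Nonempty (H ⋙ P.ιHeart ≅ t.truncGELE 0 0 ⋙ P.π)) ∧
    -- every cluster tilting subcategory `T` gives a torsion pair `(T[-1], T)`, and then the heart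
    -- is `C/T` and `H` is the quotient functor
    (∀ T : ObjectProperty C, IsClusterTilting T →
      ∃ P : TorsionPair C, P.X = T.shift (1 : ℤ) ∧ P.Y = T ∧
        P.W = T ∧ P.plus = ⊤ ∧ P.minus = ⊤ ∧ P.ιHeart.IsEquivalence ∧
        ∀ H : C ⥤ P.Heart, P.IsHeartFunctor H → Nonempty (H ⋙ P.ιHeart ≅ P.π)) := by
  refine ⟨fun P ↦ ⟨TorsionPair.isRightAdjoint_ιPlus, TorsionPair.isLeftAdjoint_ιMinus,
    fun _ adjp _ adjm ↦ TorsionPair.exists_commutation_iso adjp adjm,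
    P.exists_isHeartFunctor, fun _ h ↦ h.additive, TorsionPair.abelianHeart P,
    TorsionPair.abelianHeart_toPreadditive, fun _ h ↦ h.isHomological⟩, fun t ↦ ?_, fun T hT ↦ ?_⟩
  · refine ⟨TorsionPair.ofTStructure t, rfl, rfl, inferInstance, TorsionPair.ofTStructure_plus t,
      TorsionPair.ofTStructure_minus t, ?_, fun _ h ↦ TorsionPair.nonempty_iso_ofTStructure t h⟩
    rw [TorsionPair.ofTStructure_plus, TorsionPair.ofTStructure_minus, inf_comm]
    rfl
  · exact ⟨TorsionPair.ofClusterTilting hT, rfl, rfl, TorsionPair.ofClusterTilting_W hT,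
      TorsionPair.ofClusterTilting_plus hT, TorsionPair.ofClusterTilting_minus hT,
      TorsionPair.isEquivalence_ιHeart_ofClusterTilting hT,
      fun _ h ↦ TorsionPair.nonempty_iso_ofClusterTilting hT h⟩
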